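/- **Theorem 5.** Let $f:\mathbb{R}^n\to\mathbb{R}$ be $L$-Lipschitz, Hadamard directionally differentiable at every point and in every direction, and bounded below, with $f(x_1)-\inf f\le\Delta$ at the initial point $x_1$, where $\Delta>0$. Let $f^\circ(x;d)=\limsup_{y\to x,\,t\downarrow 0}\frac{f(y+td)-f(y)}{t}$ be the generalized directional derivative and let $\partial f(x)=\{g:\langle g,d\rangle\le f^\circ(x;d)\ \forall d\}$ be the generalized gradient. For $\delta>0$ let $\partial f(x+\delta B)=\mathrm{conv}\bigl(\bigcup_{\|y-x\|\le\delta}\partial f(y)\bigr)$. A point $x$ is called $(\delta,\epsilon)$-stationary if $d(0,\partial f(x+\delta B))\le\epsilon$. The function is accessed only through a stochastic oracle $\mathbb{O}$. Each call $\mathbb{O}(x,d)$ returns, with randomness that is fresh given the query, a random vector $g$ with $\mathbb{E}[g]=g_x$ and $\mathbb{E}\|g-g_x\|^2\le\sigma^2$, where $g_x\in\partial f(x)$ satisfies $\langle g_x,d\rangle=f'(x;d)$. Put $G=\sqrt{L^2+\sigma^2}$, let $0<\epsilon\le G$ (if $\epsilon>G$, every point is $(\delta,\epsilon)$-stationary),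 and set $$\beta=1-\frac{\epsilon^2}{64G^2},\qquad p=\frac{64G^2\ln(16G/\epsilon)}{\delta\epsilon^2},\qquad q=4Gp,\qquad K=\lfloor p\delta\rfloor,$$ $$T=\left\lceil\frac{2^{16}G^3\Delta\ln(16G/\epsilon)}{\epsilon^4\delta}\max\Bigl\{1,\frac{G\delta}{8\Delta}\Bigr\}\right\rceil .$$ Stochastic INGD sets $m_1=\mathbb{O}(x_1,0)$. For $t=1,\dots,T$ it sets $x_{t+1}=x_t-\eta_tm_t$ with $\eta_t=\frac1{p\|m_t\|+q}$, samples $y_{t+1}$ uniformly from the segment $[x_t,x_{t+1}]$, calls $g(y_{t+1})=\mathbb{O}(y_{t+1},-m_t)$ and sets $m_{t+1}=\beta m_t+(1-\beta)g(y_{t+1})$. Finally it samples $i$ uniformly from $\{1,\dots,T\}$, independently of the run, and returns $x_{\max\{i-K,1\}}$. Then: 1. $\mathbb{E}\|m_t\|<\infty$ for $1\le t\le T$, and $\displaystyle\frac1T\sum_{t=1}^T\mathbb{E}\|m_t\|\le\frac\epsilon4$. 2. The returned point $x$ is $(\delta,\epsilon)$-stationary with probability at least $2/3$. Indeed, $\Pr\{d(0,\partial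 f(x+\delta B))\ge\epsilon\}\le 1/3$. 3. Almost surely the algorithm makes exactly $T+1$ stochastic gradient calls, and $$T+1\le 2^{17}\,\frac{G^3\Delta}{\epsilon^4\delta}\,\ln\Bigl(\frac{16G}{\epsilon}\Bigr)\max\Bigl\{1,\frac{G\delta}{8\Delta}\Bigr\}.$$ In particular, if $G\delta\le 8\Delta$ then $T+1\le 2^{17}\frac{G^3\Delta}{\epsilon^4\delta}\ln\frac{16G}{\epsilon}=\tilde{\mathcal O}\bigl(\frac{G^3\Delta}{\epsilon^4\delta}\bigr)$. -/

import Mathlib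

open MeasureTheory ProbabilityTheory Filter Topology Set
open scoped NNReal ENNReal

noncomputable section

namespace StochINGD

/-- Euclidean space `ℝⁿ`. -/
abbrev E (n : ℕ) := EuclideanSpace ℝ (Fin n)

/-! ### Nonsmooth analysis -/

/-- The generalized directional derivative
`f°(x; d) = limsup_{y → x, t ↓ 0} (f (y + t d) - f y) / t`
(finite for the Lipschitz functions to which it is applied). -/
def genDirDeriv {n : ℕ} (f : E n → ℝ) (x d : E n) : ℝ :=
  limsup (fun z : E n × ℝ => (f (z.1 + z.2 • d) - f z.1) / z.2) (𝓝 x ×ˢ 𝓝[>] (0 : ℝ))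

/-- The generalized gradient `∂f(x) = {g | ⟨g, d⟩ ≤ f°(x; d) for all d}`. -/
def genGradient {n : ℕ} (f : E n → ℝ) (x : E n) : Set (E n) :=
  {g | ∀ d : E n, inner ℝ g d ≤ genDirDeriv f x d}

/-- `v` is the directional derivative `f'(x; d)` in the sense of Hadamard: along every curve `φ`
with `φ 0 = x` and right derivative `d` at `0`, the difference quotient of `f` tends to `v`. -/
def HasHadamardDirDeriv {n : ℕ} (f : E n → ℝ) (x d : E n) (v : ℝ) : Prop :=
  ∀ φ : ℝ → E n, φ 0 = x →
    Tendsto (fun t : ℝ => t⁻¹ • (φ t - φ 0)) (𝓝[>] 0) (𝓝 d) →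
    Tendsto (fun t : ℝ => t⁻¹ * (f (φ t) - f x)) (𝓝[>] 0) (𝓝 v)

/-- The function class: `L`-Lipschitz, Hadamard directionally differentiable everywhere, bounded
below, and with `f x₁ - inf f ≤ Δ` at the initial point `x₁`. -/
structure InClass {n : ℕ} (Δ : ℝ) (L : ℝ≥0) (x₁ : E n) (f : E n → ℝ) : Prop where
  lipschitz : LipschitzWith L f
  dirDiff : ∀ x d : E n, ∃ v : ℝ, HasHadamardDirDeriv f x d v
  bddBelow : BddBelow (range f)
  gap : f x₁ - ⨅ x, f x ≤ Δ

/-- The Goldstein `δ`-subdifferential `∂f(x + δB) = conv (⋃_{y ∈ x + δB} ∂f(y))`. -/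
def goldstein {n : ℕ} (f : E n → ℝ) (δ : ℝ) (x : E n) : Set (E n) :=
  convexHull ℝ (⋃ y ∈ Metric.closedBall x δ, genGradient f y)

/-- `x` is `(δ, ε)`-stationary: `d(0, ∂f(x + δB)) ≤ ε` (with the convention `d(0, ∅) = ∞`). -/
def IsStationary {n : ℕ} (f : E n → ℝ) (δ ε : ℝ) (x : E n) : Prop :=
  Metric.infEDist 0 (goldstein f δ x) ≤ ENNReal.ofReal ε

/-! ### The stochastic oracle -/

/-- A stochastic gradient oracle with variance at most `σ²`. Queried at `(x, d)` it answers with a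
random vector of law `O (x, d)`, whose mean `g_x` lies in `∂f(x)` and satisfies
`⟨g_x, d⟩ = f'(x; d)`, and `𝔼 ‖g - g_x‖² ≤ σ²`. -/
def IsStochasticOracle {n : ℕ} (f : E n → ℝ) (σ : ℝ) (O : Kernel (E n × E n) (E n)) : Prop :=
  ∀ x d : E n, ∃ gx ∈ genGradient f x,
    HasHadamardDirDeriv f x d (inner ℝ gx d) ∧
    Integrable (fun g : E n => g) (O (x, d)) ∧
    ∫ g, g ∂(O (x, d)) = gx ∧
    ∫⁻ g, ‖g - gx‖ₑ ^ 2 ∂(O (x, d)) ≤ ENNReal.ofReal (σ ^ 2)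

/-! ### The algorithm -/

/-- The record of a run: the iterates `t ↦ x_t`, the momentum vectors `t ↦ m_t` (both with indices
starting at `1`, entries not computed yet being `0`), and the number of oracle calls made. -/
abbrev Run (n : ℕ) := (ℕ → E n) × (ℕ → E n) × ℕ

/-- Initialization: call the oracle at `(x₁, 0)` and let `m₁` be its answer. -/
def initLaw {n : ℕ} (O : Kernel (E n × E n) (E n)) (x₁ : E n) : Measure (Run n) :=
  (O (x₁, 0)).bind fun g =>
    Measure.dirac (Function.update 0 1 x₁, Function.update 0 1 g, 1)

/-- The step `x_{t+1} = x_t - η_t m_t` with `η_t = 1 / (p ‖m_t‖ + q)`. -/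
def nextPoint {n : ℕ} (p q : ℝ) (x m : E n) : E n :=
  x - (1 / (p * ‖m‖ + q)) • m

/-- Iteration `t`: compute `x_{t+1}`, sample `y_{t+1}` uniformly from the segment
`[x_t, x_{t+1}]`, call the oracle at `(y_{t+1}, -m_t)`, and with its answer `g` let
`m_{t+1} = β m_t + (1 - β) g`. This is the law of the new record, given the record `s`. -/
def stepLaw {n : ℕ} (O : Kernel (E n × E n) (E n)) (p q β : ℝ) (t : ℕ) (s : Run n) :
    Measure (Run n) :=
  (volume.restrict (Icc (0 : ℝ) 1)).bind fun u =>
    (O (s.1 t + u • (nextPoint p q (s.1 t) (s.2.1 t) - s.1 t), -(s.2.1 t))).bind fun g =>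
      Measure.dirac
        (Function.update s.1 (t + 1) (nextPoint p q (s.1 t) (s.2.1 t)),
          Function.update s.2.1 (t + 1) (β • s.2.1 t + (1 - β) • g),
          s.2.2 + 1)

/-- The law of the record of the run after the iterations `1, …, T`. -/
def runLaw {n : ℕ} (O : Kernel (E n × E n) (E n)) (x₁ : E n) (p q β : ℝ) : ℕ → Measure (Run n)
  | 0 => initLaw O x₁
  | T + 1 => (runLaw O x₁ p q β T).bind (stepLaw O p q β (T + 1))

/-- The joint law of the returned point and of the number of oracle calls of Stochastic INGD: after
`T` iterations sample `i` uniformly from `{1, …, T}` and return `x_{max(i - K, 1)}`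
(truncated subtraction does no harm here). -/
def stochINGD {n : ℕ} (O : Kernel (E n × E n) (E n)) (x₁ : E n) (p q β : ℝ) (T K : ℕ) :
    Measure (E n × ℕ) :=
  (runLaw O x₁ p q β T).bind fun s =>
    (uniformOn (Icc 1 T)).bind fun i =>
      Measure.dirac (s.1 (max (i - K) 1), s.2.2)

/-! ### The laws above are probability measures (the maps under the `bind`s are measurable) -/

/-- Sampling `b` from `κ a` and then continuing with `F a b` is measurable in `a`. -/
lemma measurable_bind_kernel {α β γ : Type*} [MeasurableSpace α] [MeasurableSpace β]
    [MeasurableSpace γ] (κ : Kernel α β) [IsMarkovKernel κ] (F : α → β → Measure γ)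
    (hF : Measurable fun z : α × β => F z.1 z.2) (hP : ∀ a b, IsProbabilityMeasure (F a b)) :
    (Measurable fun a => (κ a).bind (F a)) ∧ ∀ a, IsProbabilityMeasure ((κ a).bind (F a)) := by
  have hFa : ∀ a, Measurable (F a) := fun a =>
    hF.comp (measurable_prodMk_left (x := a))
  have h : ∀ a, (κ a).bind (F a) = ((Kernel.id ×ₖ κ) a).bind fun z : α × β => F z.1 z.2 := by
    intro a
    ext S hS
    rw [Measure.bind_apply hS (hFa a).aemeasurable, Measure.bind_apply hS hF.aemeasurable,
      Kernel.prod_apply, Kernel.id_apply, Measure.dirac_prod]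
    exact (lintegral_map ((Measure.measurable_coe hS).comp hF) measurable_prodMk_left).symm
  refine ⟨?_, fun a => ⟨?_⟩⟩
  · simp_rw [h]
    exact (Measure.measurable_bind' hF).comp (Kernel.measurable _)
  · rw [Measure.bind_apply MeasurableSet.univ (hFa a).aemeasurable]
    simp

/-- An iteration is a Markov kernel on records. -/
lemma measurable_stepLaw {n : ℕ} (O : Kernel (E n × E n) (E n)) [IsMarkovKernel O]
    (p q β : ℝ) (t : ℕ) :
    Measurable (stepLaw O p q β t) ∧ ∀ s, IsProbabilityMeasure (stepLaw O p q β t s) := by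
  have hx : Measurable fun s : Run n => s.1 t := (measurable_pi_apply t).comp measurable_fst
  have hm : Measurable fun s : Run n => s.2.1 t :=
    (measurable_pi_apply t).comp (measurable_fst.comp measurable_snd)
  have hn : Measurable fun s : Run n => nextPoint p q (s.1 t) (s.2.1 t) := by
    unfold nextPoint
    fun_prop
  have hQ : Measurable fun z : Run n × ℝ =>
      ((z.1.1 t + z.2 • (nextPoint p q (z.1.1 t) (z.1.2.1 t) - z.1.1 t), -(z.1.2.1 t)) :
        E n × E n) := by
    have h0 : Measurable fun z : Run n × ℝ => z.1 := measurable_fst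
    have h1 := hx.comp h0
    have h2 := hn.comp h0
    have h3 := hm.comp h0
    exact (h1.add (measurable_snd.smul (h2.sub h1))).prodMk h3.neg
  have hN : Measurable fun z : (Run n × ℝ) × E n =>
      ((Function.update z.1.1.1 (t + 1) (nextPoint p q (z.1.1.1 t) (z.1.1.2.1 t)),
        Function.update z.1.1.2.1 (t + 1) (β • z.1.1.2.1 t + (1 - β) • z.2),
        z.1.1.2.2 + 1) : Run n) := by
    have h0 : Measurable fun z : (Run n × ℝ) × E n => z.1.1 :=
      measurable_fst.comp measurable_fst
    refine Measurable.prodMk ?_ (Measurable.prodMk ?_ ?_)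
    · exact measurable_update'.comp ((measurable_fst.comp h0).prodMk (hn.comp h0))
    · exact measurable_update'.comp ((measurable_fst.comp (measurable_snd.comp h0)).prodMk
        (((hm.comp h0).const_smul β).add (measurable_snd.const_smul (1 - β))))
    · exact (measurable_snd.comp (measurable_snd.comp h0)).add_const 1
  have : IsProbabilityMeasure (volume.restrict (Icc (0 : ℝ) 1)) := ⟨by simp⟩
  have hS := measurable_bind_kernel (O.comap _ hQ)
    (fun z g => Measure.dirac
      ((Function.update z.1.1 (t + 1) (nextPoint p q (z.1.1 t) (z.1.2.1 t)),
        Function.update z.1.2.1 (t + 1) (β • z.1.2.1 t + (1 - β) • g),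
        z.1.2.2 + 1) : Run n))
    (Measure.measurable_dirac.comp hN) fun _ _ => Measure.dirac.isProbabilityMeasure
  exact measurable_bind_kernel (Kernel.const (Run n) (volume.restrict (Icc (0 : ℝ) 1)))
    (fun s u =>
      (O (s.1 t + u • (nextPoint p q (s.1 t) (s.2.1 t) - s.1 t), -(s.2.1 t))).bind fun g =>
        Measure.dirac
          ((Function.update s.1 (t + 1) (nextPoint p q (s.1 t) (s.2.1 t)),
            Function.update s.2.1 (t + 1) (β • s.2.1 t + (1 - β) • g),
            s.2.2 + 1) : Run n))
    hS.1 fun s u => hS.2 (s, u)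

/-- The record of a run has a probability law. -/
instance isProbabilityMeasure_runLaw {n : ℕ} (O : Kernel (E n × E n) (E n)) [IsMarkovKernel O]
    (x₁ : E n) (p q β : ℝ) (T : ℕ) : IsProbabilityMeasure (runLaw O x₁ p q β T) := by
  induction T with
  | zero =>
    have h : Measurable fun g : E n =>
        ((Function.update 0 1 x₁, Function.update 0 1 g, 1) : Run n) :=
      measurable_const.prodMk ((measurable_update _).prodMk measurable_const)
    have h' : Measurable fun g : E n => Measure.dirac
        ((Function.update 0 1 x₁, Function.update 0 1 g, 1) : Run n) :=
      Measure.measurable_dirac.comp h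
    refine ⟨?_⟩
    simp only [runLaw, initLaw]
    rw [Measure.bind_apply MeasurableSet.univ h'.aemeasurable]
    simp
  | succ T ih =>
    obtain ⟨h₁, h₂⟩ := measurable_stepLaw O p q β (T + 1)
    refine ⟨?_⟩
    simp only [runLaw]
    rw [Measure.bind_apply MeasurableSet.univ h₁.aemeasurable]
    simp

/-- The output of the algorithm has a probability law. -/
lemma isProbabilityMeasure_stochINGD {n : ℕ} (O : Kernel (E n × E n) (E n)) [IsMarkovKernel O]
    (x₁ : E n) (p q β : ℝ) (T K : ℕ) (hT : 1 ≤ T) :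
    IsProbabilityMeasure (stochINGD O x₁ p q β T K) := by
  have : IsProbabilityMeasure (uniformOn (Icc 1 T)) :=
    isProbabilityMeasure_uniformOn (finite_Icc 1 T) (nonempty_Icc.2 hT)
  have hN : Measurable fun z : Run n × ℕ => ((z.1.1 (max (z.2 - K) 1), z.1.2.2) : E n × ℕ) := by
    refine measurable_from_prod_countable_left fun i => ?_
    have h : Measurable fun s : Run n => s.1 (max (i - K) 1) :=
      (measurable_pi_apply _).comp measurable_fst
    exact h.prodMk (measurable_snd.comp measurable_snd)
  have hS := measurable_bind_kernel (Kernel.const (Run n) (uniformOn (Icc 1 T)))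
    (fun s i => Measure.dirac ((s.1 (max (i - K) 1), s.2.2) : E n × ℕ))
    (Measure.measurable_dirac.comp hN) fun _ _ => Measure.dirac.isProbabilityMeasure
  simp only [Kernel.const_apply] at hS
  have := hS.2
  refine ⟨?_⟩
  unfold stochINGD
  rw [Measure.bind_apply MeasurableSet.univ hS.1.aemeasurable]
  simp

end StochINGD

end

/-!
Write `c = 4 G`, so that `q = c p` and the step is `η_t = 1 / (p (‖m_t‖ + c))`.

*Momentum.* Since `y_{t+1}` is uniform on the segment `[x_t, x_{t+1}]` and the oracle answers with a
subgradient that realizes the directional derivative along `-m_t`, the conditional mean of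
`⟨g(y_{t+1}), m_t⟩` is exactly `(f x_t - f x_{t+1}) / η_t` (`inner_integral_gradKernel`): the
fundamental theorem of calculus holds along segments because `f` is Lipschitz and has right
derivatives along rays. Expanding `‖m_{t+1}‖²` gives a drift for the squared norm in which the
decrease of `f` carries the random factor `‖m_t‖ + c`. The potential `ψ` with
`dψ/du = 1 / (√u + c)` in `u = ‖m‖²` removes it: by concavity of `ψ` in `u`,
`ψ(‖m‖) + C (f x - inf f)` is a Lyapunov function which decreases by `(1 - β²) a² / (a + c)`, where
`a = ‖m_t‖`, up to the variance term `(1 - β)² G² / c` (`lintegral_lyapunov_stepKernel_le`). With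
the given parameters the sum over `t` leaves an average of `𝔼 ‖m_t‖` of at most `ε / 8`
(`sum_lintegral_enorm_momentum_le`).

*Stationarity.* A step is shorter than `1 / p` and `K ≤ p δ`, so all points queried during `K`
iterations lie within `δ` of the point where these start. Given the state at that point, the mean of
the momentum `K` iterations later is `β^K m` plus `1 - β^K` times an element of the closed
Goldstein subdifferential (`MeanDecomposition.bind_stepKernel_pow`). Hence the distance of the
latter from `0` is at most `(𝔼[‖m_i‖ | x, m] + β^K ‖m‖) / (1 - β^K)`, and Markov's inequality bounds
the failure probability (`measure_le_infEDist_le`). The event in question is measurable because the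
distance is lower semicontinuous in the point (`lowerSemicontinuous_infEDist_goldstein`).

Expectations along the run are lower Lebesgue integrals against the Markov chain `(x_t, m_t)` with
kernel `stepKernel`, which avoids integrability conditions on the Lyapunov function;
`lintegral_state_runLaw` identifies this chain inside the law of the run.
-/

noncomputable section

namespace StochINGD

variable {n : ℕ} {f : E n → ℝ} {L : ℝ≥0}

/-! ### The generalized gradient of a Lipschitz function -/

lemma abs_diffQuotient_le (hf : LipschitzWith L f) (d : E n) (z : E n × ℝ) :
    |(f (z.1 + z.2 • d) - f z.1) / z.2| ≤ L * ‖d‖ := by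
  have h := hf.dist_le_mul (z.1 + z.2 • d) z.1
  rw [Real.dist_eq, dist_eq_norm, add_sub_cancel_left, norm_smul, Real.norm_eq_abs] at h
  rw [abs_div]
  refine div_le_of_le_mul₀ (abs_nonneg _) (by positivity) ?_
  linarith

lemma isBoundedUnder_diffQuotient (hf : LipschitzWith L f) (d : E n) (F : Filter (E n × ℝ)) :
    F.IsBoundedUnder (· ≤ ·) fun z : E n × ℝ => (f (z.1 + z.2 • d) - f z.1) / z.2 :=
  isBoundedUnder_of ⟨L * ‖d‖, fun z => (abs_le.1 (abs_diffQuotient_le hf d z)).2⟩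

lemma genDirDeriv_le_of_eventually (hf : LipschitzWith L f) {x d : E n} {c : ℝ}
    (h : ∀ᶠ z in 𝓝 x ×ˢ 𝓝[>] (0 : ℝ), (f (z.1 + z.2 • d) - f z.1) / z.2 ≤ c) :
    genDirDeriv f x d ≤ c :=
  limsup_le_of_le (isBoundedUnder_of ⟨-(L * ‖d‖), fun z =>
    (abs_le.1 (abs_diffQuotient_le hf d z)).1⟩ : IsBoundedUnder (· ≥ ·) _ _).isCoboundedUnder_le h

lemma genDirDeriv_le (hf : LipschitzWith L f) (x d : E n) : genDirDeriv f x d ≤ L * ‖d‖ :=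
  genDirDeriv_le_of_eventually hf
    (Eventually.of_forall fun z => (abs_le.1 (abs_diffQuotient_le hf d z)).2)

lemma norm_le_of_mem_genGradient (hf : LipschitzWith L f) {x g : E n}
    (hg : g ∈ genGradient f x) : ‖g‖ ≤ L := by
  have h := (hg g).trans (genDirDeriv_le hf x g)
  rw [real_inner_self_eq_norm_sq, sq] at h
  rcases (norm_nonneg g).eq_or_lt with h0 | h0
  · rw [← h0]; exact L.2
  · exact le_of_mul_le_mul_right h h0

/-- Upper semicontinuity of `x ↦ f°(x; d)`. -/
lemma eventually_genDirDeriv_le (hf : LipschitzWith L f) {x d : E n} {c : ℝ}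
    (h : genDirDeriv f x d < c) : ∀ᶠ y in 𝓝 x, genDirDeriv f y d ≤ c := by
  have h1 := eventually_lt_of_limsup_lt h (isBoundedUnder_diffQuotient hf d _)
  obtain ⟨pa, ha, pb, hb, hab⟩ := eventually_prod_iff.1 h1
  filter_upwards [eventually_eventually_nhds.2 ha] with y hy
  exact genDirDeriv_le_of_eventually hf
    (eventually_prod_iff.2 ⟨pa, hy, pb, hb, fun h1 _ h2 => (hab h1 h2).le⟩)

lemma isClosed_graph_genGradient (hf : LipschitzWith L f) :
    IsClosed {z : E n × E n | z.2 ∈ genGradient f z.1} := by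
  have h : {z : E n × E n | z.2 ∈ genGradient f z.1} =
      ⋂ d : E n, {z | inner ℝ z.2 d ≤ genDirDeriv f z.1 d} := by
    ext z; simp [genGradient]
  rw [h]
  refine isClosed_iInter fun d => ?_
  rw [← isOpen_compl_iff, isOpen_iff_mem_nhds]
  intro z hz
  simp only [mem_compl_iff, mem_ofPred_eq, not_le] at hz
  obtain ⟨c, hc1, hc2⟩ := exists_between hz
  have h1 : ∀ᶠ w : E n × E n in 𝓝 z, genDirDeriv f w.1 d ≤ c :=
    continuous_fst.continuousAt.eventually (eventually_genDirDeriv_le hf hc1)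
  have h2 : ∀ᶠ w : E n × E n in 𝓝 z, c < inner ℝ w.2 d :=
    (continuous_snd.inner continuous_const).continuousAt.eventually (lt_mem_nhds hc2)
  filter_upwards [h1, h2] with w hw1 hw2
  simp only [mem_compl_iff, mem_ofPred_eq, not_le]
  exact hw1.trans_lt hw2

/-- Upper semicontinuity of the generalized gradients over a ball: a set-valued map with closed
graph and values in a fixed compact set is upper semicontinuous. -/
lemma eventually_iUnion_genGradient_subset_thickening (hf : LipschitzWith L f) (δ : ℝ) (x : E n)
    {ρ : ℝ} (hρ : 0 < ρ) :
    ∀ᶠ x' in 𝓝 x, (⋃ y ∈ Metric.closedBall x' δ, genGradient f y) ⊆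
      Metric.thickening ρ (⋃ y ∈ Metric.closedBall x δ, genGradient f y) := by
  set C := ⋃ y ∈ Metric.closedBall x δ, genGradient f y with hC
  set A : Set (E n × E n) := (Metric.closedBall x (δ + 1) ×ˢ Metric.closedBall 0 (L : ℝ)) ∩
    ({z | z.2 ∈ genGradient f z.1} ∩ {z | z.2 ∉ Metric.thickening ρ C}) with hA
  have hAc : IsCompact A := by
    refine ((isCompact_closedBall _ _).prod (isCompact_closedBall _ _)).inter_right
      ((isClosed_graph_genGradient hf).inter ?_)
    exact (Metric.isOpen_thickening.preimage continuous_snd).isClosed_compl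
  have hAd : ∀ z ∈ A, δ < dist z.1 x := by
    rintro z ⟨-, hz1, hz2⟩
    by_contra! hcon
    exact hz2 (Metric.self_subset_thickening hρ _ (mem_biUnion hcon hz1))
  obtain ⟨r, hr, hrA⟩ : ∃ r > δ, ∀ z ∈ A, r ≤ dist z.1 x := by
    rcases A.eq_empty_or_nonempty with h0 | h0
    · exact ⟨δ + 1, by linarith, by simp [h0]⟩
    · obtain ⟨z, hz, hmin⟩ := hAc.exists_isMinOn h0
        (f := fun z : E n × E n => dist z.1 x) (by fun_prop)
      exact ⟨_, hAd z hz, fun w hw => hmin hw⟩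
  filter_upwards [Metric.ball_mem_nhds x (lt_min one_pos (sub_pos.2 hr))] with x' hx' g hg
  obtain ⟨y, hy, hgy⟩ := mem_iUnion₂.1 hg
  rw [Metric.mem_ball, lt_min_iff] at hx'
  rw [Metric.mem_closedBall] at hy
  have htri := dist_triangle y x' x
  by_contra hcon
  have hmem : (y, g) ∈ A := by
    refine ⟨⟨?_, ?_⟩, hgy, hcon⟩
    · rw [Metric.mem_closedBall]; linarith
    · simpa using norm_le_of_mem_genGradient hf hgy
  have := hrA _ hmem
  simp only at this
  linarith

/-- The distance from `0` to the Goldstein subdifferential is lower semicontinuous in the point. -/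
lemma lowerSemicontinuous_infEDist_goldstein (hf : LipschitzWith L f) (δ : ℝ) :
    LowerSemicontinuous fun x => Metric.infEDist 0 (goldstein f δ x) := by
  intro x c hc
  obtain ⟨r, hr, hcr⟩ := ENNReal.lt_iff_exists_add_pos_lt.1 hc
  filter_upwards [eventually_iUnion_genGradient_subset_thickening hf δ x (NNReal.coe_pos.2 hr)]
    with x' hx'
  have hsub : goldstein f δ x' ⊆ Metric.thickening r (goldstein f δ x) :=
    convexHull_min (hx'.trans (Metric.thickening_subset_of_subset _ (subset_convexHull _ _)))
      ((convex_convexHull _ _).thickening _)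
  have h : Metric.infEDist 0 (goldstein f δ x) ≤
      Metric.infEDist 0 (goldstein f δ x') + r := by
    calc _ ≤ Metric.infEDist 0 (Metric.thickening r (goldstein f δ x)) + ENNReal.ofReal r :=
          Metric.infEDist_le_infEDist_thickening_add
      _ ≤ _ := by
          rw [ENNReal.ofReal_coe_nnreal]
          gcongr
  exact lt_of_add_lt_add_right (hcr.trans_le h)

lemma measurableSet_le_infEDist_goldstein (hf : LipschitzWith L f) (δ : ℝ) (c : ℝ≥0∞) :
    MeasurableSet {x | c ≤ Metric.infEDist 0 (goldstein f δ x)} :=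
  measurableSet_le measurable_const (lowerSemicontinuous_infEDist_goldstein hf δ).measurable

/-! ### The fundamental theorem of calculus along a segment -/

lemma HasHadamardDirDeriv.tendsto_ray {x d : E n} {v : ℝ} (h : HasHadamardDirDeriv f x d v) :
    Tendsto (fun t : ℝ => t⁻¹ * (f (x + t • d) - f x)) (𝓝[>] 0) (𝓝 v) := by
  refine h (fun t => x + t • d) (by simp) ?_
  refine tendsto_const_nhds.congr' ?_
  filter_upwards [self_mem_nhdsWithin] with t ht
  simp [smul_smul, inv_mul_cancel₀ (ne_of_gt (mem_Ioi.1 ht))]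

lemma HasHadamardDirDeriv.hasDerivWithinAt {x d : E n} {s v : ℝ}
    (h : HasHadamardDirDeriv f (x + s • d) d v) :
    HasDerivWithinAt (fun t : ℝ => f (x + t • d)) v (Ioi s) s := by
  rw [hasDerivWithinAt_iff_tendsto_slope' (by simp)]
  have h1 : Tendsto (fun t : ℝ => t - s) (𝓝[>] s) (𝓝[>] 0) := by
    refine tendsto_nhdsWithin_iff.2 ⟨?_, ?_⟩
    · exact ((continuous_id.sub continuous_const).tendsto' s 0 (by simp)).mono_left
        nhdsWithin_le_nhds
    · filter_upwards [self_mem_nhdsWithin] with t ht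
      exact sub_pos.2 (mem_Ioi.1 ht)
  refine (h.tendsto_ray.comp h1).congr fun t => ?_
  simp only [Function.comp, slope, vsub_eq_sub, smul_eq_mul]
  rw [add_assoc, ← add_smul, add_sub_cancel]

/-- A Lipschitz function is the integral of its directional derivatives along a segment; the step
is `η` times the direction `d`. -/
lemma integral_dirDeriv_segment (hf : LipschitzWith L f) (x d : E n) {η : ℝ} (hη : 0 < η)
    (v : ℝ → ℝ) (hv : ∀ u, HasHadamardDirDeriv f (x + u • (η • d)) d (v u))
    (hint : IntervalIntegrable v volume 0 1) :
    η * ∫ u in (0 : ℝ)..1, v u = f (x + η • d) - f x := by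
  have h := intervalIntegral.integral_eq_sub_of_hasDeriv_right
    (f := fun u : ℝ => f (x + u • (η • d))) (f' := fun u => η * v u) (a := 0) (b := 1)
    ?_ ?_ (hint.const_mul η)
  · simpa [intervalIntegral.integral_const_mul] using h
  · exact (hf.continuous.comp (by fun_prop)).continuousOn
  · intro u _
    have h1 := hv u
    rw [smul_smul] at h1
    have h2 := h1.hasDerivWithinAt.comp u
      (h₂ := fun t : ℝ => f (x + t • d)) (h := fun t : ℝ => t * η) (s := Ioi u)
      ((hasDerivAt_mul_const η).hasDerivWithinAt) ?_
    · simp only [Function.comp_def] at h2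
      simpa [smul_smul, mul_comm] using h2
    · intro t ht
      exact mul_lt_mul_of_pos_right ht hη

/-! ### Moments of the oracle answers -/

lemma enorm_sq_eq_ofReal (g : E n) : ‖g‖ₑ ^ 2 = ENNReal.ofReal (‖g‖ ^ 2) := by
  rw [ENNReal.ofReal_pow (norm_nonneg _), ofReal_norm]

section Oracle

variable {σ : ℝ} {O : Kernel (E n × E n) (E n)}

lemma IsStochasticOracle.mean_mem (hO : IsStochasticOracle f σ O) (x d : E n) :
    ∫ g, g ∂(O (x, d)) ∈ genGradient f x := by
  obtain ⟨gx, h1, -, -, h2, -⟩ := hO x d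
  rwa [h2]

lemma IsStochasticOracle.norm_mean_le (hO : IsStochasticOracle f σ O) (hf : LipschitzWith L f)
    (y : E n × E n) : ‖∫ g, g ∂(O y)‖ ≤ L :=
  norm_le_of_mem_genGradient hf (hO.mean_mem y.1 y.2)

lemma IsStochasticOracle.hasHadamardDirDeriv (hO : IsStochasticOracle f σ O) (x d : E n) :
    HasHadamardDirDeriv f x d (inner ℝ (∫ g, g ∂(O (x, d))) d) := by
  obtain ⟨gx, -, h1, -, h2, -⟩ := hO x d
  rwa [h2]

lemma IsStochasticOracle.lintegral_enorm_sq_le [IsMarkovKernel O] (hO : IsStochasticOracle f σ O)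
    (hf : LipschitzWith L f) (z : E n × E n) :
    ∫⁻ g, ‖g‖ₑ ^ 2 ∂(O z) ≤ ENNReal.ofReal ((L : ℝ) ^ 2 + σ ^ 2) := by
  obtain ⟨x, d⟩ := z
  obtain ⟨gx, h1, -, hint, hmean, hvar⟩ := hO x d
  have hm : MemLp (fun g : E n => g - gx) 2 (O (x, d)) := by
    refine ⟨(hint.sub (integrable_const gx)).1, ?_⟩
    rw [eLpNorm_lt_top_iff_lintegral_rpow_enorm_lt_top (by simp) (by simp)]
    simpa using hvar.trans_lt ENNReal.ofReal_lt_top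
  have hsq : Integrable (fun g : E n => ‖g - gx‖ ^ 2) (O (x, d)) :=
    (memLp_two_iff_integrable_sq_norm hm.1).1 hm
  have hin : Integrable (fun g : E n => inner ℝ gx (g - gx)) (O (x, d)) :=
    (hint.sub (integrable_const gx)).const_inner gx
  have hexp : (fun g : E n => ‖g‖ ^ 2) =
      fun g => ‖gx‖ ^ 2 + 2 * inner ℝ gx (g - gx) + ‖g - gx‖ ^ 2 := by
    ext g
    rw [← norm_add_sq_real, add_sub_cancel]
  have hzero : ∫ g, inner ℝ gx (g - gx) ∂(O (x, d)) = 0 := by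
    have h := integral_inner (𝕜 := ℝ) (hint.sub (integrable_const gx)) gx
    rw [integral_sub' hint (integrable_const gx), hmean] at h
    simpa using h
  have hvar' : ∫ g, ‖g - gx‖ ^ 2 ∂(O (x, d)) ≤ σ ^ 2 := by
    rw [integral_eq_lintegral_of_nonneg_ae (Eventually.of_forall fun _ => by positivity) hsq.1]
    refine ENNReal.toReal_le_of_le_ofReal (sq_nonneg σ) ?_
    simp_rw [← enorm_sq_eq_ofReal]
    exact hvar
  have hsq' : Integrable (fun g : E n => ‖g‖ ^ 2) (O (x, d)) := by
    rw [hexp]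
    exact ((integrable_const _).add (hin.const_mul 2)).add hsq
  have hL := norm_le_of_mem_genGradient hf h1
  calc ∫⁻ g, ‖g‖ₑ ^ 2 ∂(O (x, d))
      = ∫⁻ g, ENNReal.ofReal (‖g‖ ^ 2) ∂(O (x, d)) := by
        simp_rw [← enorm_sq_eq_ofReal]
    _ = ENNReal.ofReal (∫ g, ‖g‖ ^ 2 ∂(O (x, d))) :=
        (ofReal_integral_eq_lintegral_ofReal hsq'
          (Eventually.of_forall fun _ => by positivity)).symm
    _ ≤ _ := by
        refine ENNReal.ofReal_le_ofReal ?_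
        have hadd : Integrable (fun g : E n => ‖gx‖ ^ 2 + 2 * inner ℝ gx (g - gx)) (O (x, d)) :=
          (integrable_const _).add (hin.const_mul 2)
        rw [hexp, integral_add hadd hsq,
          integral_add (integrable_const _) (hin.const_mul 2), integral_const_mul, hzero]
        simp only [integral_const, probReal_univ, one_smul]
        nlinarith [norm_nonneg gx]

end Oracle

/-! ### One iteration as a Markov kernel on the pairs `(x_t, m_t)` -/

lemma measurable_nextPoint (p q : ℝ) : Measurable fun z : E n × E n => nextPoint p q z.1 z.2 := by
  unfold nextPoint
  fun_prop

/-- The query made in state `z = (x, m)` when `u ∈ [0, 1]` is drawn: the point at parameter `u` of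
the segment from `x` to the next iterate, together with the direction `-m`. -/
def query (p q : ℝ) (w : (E n × E n) × ℝ) : E n × E n :=
  (w.1.1 + w.2 • (nextPoint p q w.1.1 w.1.2 - w.1.1), -w.1.2)

lemma measurable_query (p q : ℝ) : Measurable (query (n := n) p q) := by
  have h := (measurable_nextPoint (n := n) p q).comp
    (measurable_fst : Measurable fun w : (E n × E n) × ℝ => w.1)
  have h1 : Measurable fun w : (E n × E n) × ℝ => w.1.1 := measurable_fst.comp measurable_fst
  have h2 : Measurable fun w : (E n × E n) × ℝ => w.1.2 := measurable_snd.comp measurable_fst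
  exact (h1.add (measurable_snd.smul (h.sub h1))).prodMk h2.neg

instance isProbabilityMeasure_restrict_Icc :
    IsProbabilityMeasure (volume.restrict (Icc (0 : ℝ) 1)) := ⟨by simp⟩

/-- The law of the query made in a given state. -/
def queryKernel (n : ℕ) (p q : ℝ) : Kernel (E n × E n) (E n × E n) :=
  (Kernel.id ×ₖ Kernel.const _ (volume.restrict (Icc (0 : ℝ) 1))).map (query p q)

instance (p q : ℝ) : IsMarkovKernel (queryKernel n p q) :=
  Kernel.IsMarkovKernel.map _ (measurable_query p q)

lemma queryKernel_apply (p q : ℝ) (z : E n × E n) :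
    queryKernel n p q z = (volume.restrict (Icc (0 : ℝ) 1)).map fun u => query p q (z, u) := by
  rw [queryKernel, Kernel.map_apply _ (measurable_query p q), Kernel.prod_apply, Kernel.id_apply,
    Kernel.const_apply, Measure.dirac_prod, Measure.map_map (measurable_query p q)
    measurable_prodMk_left]
  rfl

/-- The law of the oracle's answer during an iteration started in a given state. -/
def gradKernel (O : Kernel (E n × E n) (E n)) (p q : ℝ) : Kernel (E n × E n) (E n) :=
  O ∘ₖ queryKernel n p q

/-- The new state, given the old one and the oracle's answer. -/
def nextState (p q β : ℝ) (w : (E n × E n) × E n) : E n × E n :=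
  (nextPoint p q w.1.1 w.1.2, β • w.1.2 + (1 - β) • w.2)

lemma measurable_nextState (p q β : ℝ) : Measurable (nextState (n := n) p q β) := by
  have h := (measurable_nextPoint (n := n) p q).comp
    (measurable_fst : Measurable fun w : (E n × E n) × E n => w.1)
  exact h.prodMk (((measurable_snd.comp measurable_fst).const_smul β).add
    (measurable_snd.const_smul (1 - β)))

/-- The transition kernel of the Markov chain `(x_t, m_t)`. -/
def stepKernel (O : Kernel (E n × E n) (E n)) (p q β : ℝ) : Kernel (E n × E n) (E n × E n) :=
  (Kernel.id ×ₖ gradKernel O p q).map (nextState p q β)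

section Kernels

variable (O : Kernel (E n × E n) (E n)) [IsMarkovKernel O] (p q β : ℝ)

instance : IsMarkovKernel (gradKernel O p q) := by
  unfold gradKernel; infer_instance

instance : IsMarkovKernel (stepKernel O p q β) :=
  Kernel.IsMarkovKernel.map _ (measurable_nextState p q β)

lemma stepKernel_apply (z : E n × E n) :
    stepKernel O p q β z = (gradKernel O p q z).map fun g => nextState p q β (z, g) := by
  rw [stepKernel, Kernel.map_apply _ (measurable_nextState p q β), Kernel.prod_apply,
    Kernel.id_apply, Measure.dirac_prod, Measure.map_map (measurable_nextState p q β)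
    measurable_prodMk_left]
  rfl

lemma measurable_nextState_right (z : E n × E n) : Measurable fun g => nextState p q β (z, g) :=
  (measurable_nextState p q β).comp measurable_prodMk_left

lemma lintegral_stepKernel (z : E n × E n) {h : E n × E n → ℝ≥0∞} (hh : Measurable h) :
    ∫⁻ w, h w ∂(stepKernel O p q β z)
      = ∫⁻ g, h (nextPoint p q z.1 z.2, β • z.2 + (1 - β) • g) ∂(gradKernel O p q z) := by
  rw [stepKernel_apply, lintegral_map hh (measurable_nextState_right p q β z)]
  rfl

end Kernels

/-! ### Moments of the averaged oracle answer -/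

lemma lintegral_gradKernel_le (O : Kernel (E n × E n) (E n)) (p q : ℝ) {h : E n → ℝ≥0∞}
    (hh : Measurable h) {C : ℝ≥0∞}
    (hC : ∀ z, ∫⁻ g, h g ∂(O z) ≤ C) (z : E n × E n) : ∫⁻ g, h g ∂(gradKernel O p q z) ≤ C := by
  rw [gradKernel, Kernel.lintegral_comp _ _ _ hh]
  exact (lintegral_mono hC).trans (by simp)

lemma measurable_oracleMean (O : Kernel (E n × E n) (E n)) :
    Measurable fun y : E n × E n => ∫ g, g ∂(O y) :=
  (measurable_id.stronglyMeasurable.integral_kernel (κ := O)).measurable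

lemma integrable_oracleMean_query {σ : ℝ} {O : Kernel (E n × E n) (E n)} {p q : ℝ}
    (hO : IsStochasticOracle f σ O) (hf : LipschitzWith L f)
    (z : E n × E n) :
    Integrable (fun u : ℝ => ∫ g, g ∂(O (query p q (z, u)))) (volume.restrict (Icc 0 1)) := by
  refine Integrable.of_bound (C := L) ?_
    (Eventually.of_forall fun u => hO.norm_mean_le hf _)
  exact ((measurable_oracleMean O).comp
    ((measurable_query p q).comp measurable_prodMk_left)).aestronglyMeasurable

section GradKernel

variable {σ : ℝ} {O : Kernel (E n × E n) (E n)} [IsMarkovKernel O] {p q β : ℝ}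

lemma lintegral_enorm_sq_gradKernel_le (hO : IsStochasticOracle f σ O) (hf : LipschitzWith L f)
    (z : E n × E n) :
    ∫⁻ g, ‖g‖ₑ ^ 2 ∂(gradKernel O p q z) ≤ ENNReal.ofReal ((L : ℝ) ^ 2 + σ ^ 2) :=
  lintegral_gradKernel_le O p q (by fun_prop) (hO.lintegral_enorm_sq_le hf) z

lemma memLp_two_of_lintegral_enorm_sq_le {μ : Measure (E n)} {C : ℝ}
    (h : ∫⁻ g, ‖g‖ₑ ^ 2 ∂μ ≤ ENNReal.ofReal C) : MemLp (fun g : E n => g) 2 μ := by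
  refine ⟨by fun_prop, ?_⟩
  rw [eLpNorm_lt_top_iff_lintegral_rpow_enorm_lt_top (by simp) (by simp)]
  simpa using h.trans_lt ENNReal.ofReal_lt_top

lemma integrable_gradKernel (hO : IsStochasticOracle f σ O) (hf : LipschitzWith L f)
    (z : E n × E n) : Integrable (fun g : E n => g) (gradKernel O p q z) :=
  (memLp_two_of_lintegral_enorm_sq_le
    (lintegral_enorm_sq_gradKernel_le hO hf z)).integrable (by simp)

lemma integral_gradKernel (hO : IsStochasticOracle f σ O) (hf : LipschitzWith L f)
    (z : E n × E n) :
    ∫ g, g ∂(gradKernel O p q z)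
      = ∫ u in Icc (0 : ℝ) 1, ∫ g, g ∂(O (query p q (z, u))) := by
  have h := integrable_gradKernel (p := p) (q := q) hO hf z
  rw [gradKernel] at h ⊢
  rw [Kernel.integral_comp h, queryKernel_apply, integral_map]
  · exact ((measurable_query p q).comp measurable_prodMk_left).aemeasurable
  · exact (measurable_oracleMean O).aestronglyMeasurable

/-- The averaged answer is a mean of generalized gradients along the segment, hence lies in the
closure of a Goldstein subdifferential whose ball contains the segment. -/
lemma integral_gradKernel_mem (hO : IsStochasticOracle f σ O) (hf : LipschitzWith L f)
    {c : E n} {δ : ℝ} {z : E n × E n} (h0 : z.1 ∈ Metric.closedBall c δ)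
    (h1 : nextPoint p q z.1 z.2 ∈ Metric.closedBall c δ) :
    ∫ g, g ∂(gradKernel O p q z) ∈ closure (goldstein f δ c) := by
  rw [integral_gradKernel hO hf]
  refine (convex_convexHull ℝ _).closure.integral_mem isClosed_closure ?_
    (integrable_oracleMean_query hO hf z)
  filter_upwards [ae_restrict_mem measurableSet_Icc] with u hu
  refine subset_closure (subset_convexHull ℝ _ (mem_biUnion ?_ (hO.mean_mem _ _)))
  have := (convex_closedBall c δ).add_smul_sub_mem h0 h1 hu
  exact this

/-- The averaged answer predicts the decrease of `f` exactly: a uniform point of the segment turns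
the mean directional derivative into a difference quotient. -/
lemma inner_integral_gradKernel (hO : IsStochasticOracle f σ O) (hf : LipschitzWith L f)
    {z : E n × E n} (hη : 0 < p * ‖z.2‖ + q) :
    inner ℝ z.2 (∫ g, g ∂(gradKernel O p q z))
      = (p * ‖z.2‖ + q) * (f z.1 - f (nextPoint p q z.1 z.2)) := by
  obtain ⟨x, m⟩ := z
  set η : ℝ := 1 / (p * ‖m‖ + q) with hηdef
  have hηpos : 0 < η := one_div_pos.2 hη
  have hnext : nextPoint p q x m = x + η • (-m) := by
    simp [nextPoint, hηdef, sub_eq_add_neg]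
  have hint := integrable_oracleMean_query (p := p) (q := q) hO hf (x, m)
  have hq : ∀ u : ℝ, query p q ((x, m), u) = (x + u • (η • (-m)), -m) := by
    intro u; simp [query, hnext]
  have hv := integral_dirDeriv_segment hf x (-m) hηpos
    (fun u => inner ℝ (∫ g, g ∂(O (query p q ((x, m), u)))) (-m)) (fun u => by
      rw [hq]; exact hO.hasHadamardDirDeriv _ _) (by
      rw [intervalIntegrable_iff_integrableOn_Icc_of_le zero_le_one]
      exact hint.inner_const (-m))
  rw [intervalIntegral.integral_of_le zero_le_one, ← integral_Icc_eq_integral_Ioc] at hv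
  have h2 : ∫ u in Icc (0 : ℝ) 1, inner ℝ (∫ g, g ∂(O (query p q ((x, m), u)))) (-m)
      = inner ℝ (-m) (∫ g, g ∂(gradKernel O p q (x, m))) := by
    rw [integral_gradKernel hO hf, ← integral_inner hint]
    simp_rw [real_inner_comm]
  rw [h2, ← hnext, inner_neg_left] at hv
  have h3 : (p * ‖m‖ + q) * η = 1 := by rw [hηdef]; field_simp
  simp only
  calc _ = (p * ‖m‖ + q) * η * inner ℝ m (∫ g, g ∂(gradKernel O p q (x, m))) := by
        rw [h3, one_mul]
    _ = _ := by linear_combination (-(p * ‖m‖ + q)) * hv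

end GradKernel

/-! ### The potential -/

/-- The potential `ψ(b) = 2 (b - c log (1 + b / c))` for the norm of the momentum. As a function of
`u = b²` it is concave with slope `1 / (√u + c)`, which with `c = q / p` is the step size `η_t` up
to the factor `p`. -/
def potential (c b : ℝ) : ℝ := 2 * (b - c * Real.log (1 + b / c))

lemma potential_zero (c : ℝ) : potential c 0 = 0 := by simp [potential]

lemma potential_nonneg {c b : ℝ} (hc : 0 < c) (hb : 0 ≤ b) : 0 ≤ potential c b := by
  have h := Real.log_le_sub_one_of_pos (show 0 < 1 + b / c by positivity)
  have h2 : c * Real.log (1 + b / c) ≤ c * (b / c) := by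
    refine mul_le_mul_of_nonneg_left ?_ hc.le
    linarith
  rw [mul_div_cancel₀ b hc.ne'] at h2
  unfold potential
  linarith

lemma measurable_potential (c : ℝ) : Measurable (potential c) := by
  unfold potential
  fun_prop

/-- The tangent inequality for the concave function `u ↦ ψ(√u)` at `u = a²`. -/
lemma potential_le_tangent {a b c : ℝ} (ha : 0 ≤ a) (hb : 0 ≤ b) (hc : 0 < c) :
    potential c b ≤ potential c a + (b ^ 2 - a ^ 2) / (a + c) := by
  set φ : ℝ → ℝ := fun b => b ^ 2 / (a + c) - potential c b with hφ
  have hd : ∀ b, 0 ≤ b → HasDerivAt φ (2 * b * (b - a) / ((a + c) * (b + c))) b := by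
    intro b hb
    have h1 : HasDerivAt (fun b : ℝ => Real.log (1 + b / c)) (1 / c / (1 + b / c)) b :=
      (((hasDerivAt_id b).div_const c).const_add 1).log (by simp only [id]; positivity)
    have h2 := ((hasDerivAt_pow 2 b).div_const (a + c)).sub
      (((hasDerivAt_id b).sub (h1.const_mul c)).const_mul 2)
    refine h2.congr_deriv ?_
    have : c + b ≠ 0 := by positivity
    simp only [Nat.cast_ofNat, Nat.add_one_sub_one, pow_one]
    field_simp
    ring
  have hcont : ContinuousOn φ (Ici 0) := fun b hb => (hd b hb).continuousAt.continuousWithinAt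
  suffices h : φ a ≤ φ b by
    simp only [hφ] at h
    rw [sub_div]
    linarith
  rcases le_total a b with hab | hab
  · refine monotoneOn_of_deriv_nonneg (convex_Ici a) (hcont.mono (Ici_subset_Ici.2 ha)) ?_ ?_
      self_mem_Ici hab hab
    · intro y hy
      rw [interior_Ici] at hy
      exact (hd y (ha.trans hy.le)).differentiableAt.differentiableWithinAt
    · intro y hy
      rw [interior_Ici] at hy
      have hy0 : 0 ≤ y := ha.trans hy.le
      rw [(hd y hy0).deriv]
      have := sub_nonneg.2 (le_of_lt (mem_Ioi.1 hy))
      positivity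
  · refine antitoneOn_of_deriv_nonpos (convex_Icc 0 a) (hcont.mono Icc_subset_Ici_self) ?_ ?_
      ⟨hb, hab⟩ ⟨ha, le_rfl⟩ hab
    · intro y hy
      rw [interior_Icc] at hy
      exact (hd y hy.1.le).differentiableAt.differentiableWithinAt
    · intro y hy
      rw [interior_Icc] at hy
      have hy0 : 0 < y := hy.1
      rw [(hd y hy0.le).deriv]
      have := hy.2
      refine div_nonpos_of_nonpos_of_nonneg ?_ (by positivity)
      exact mul_nonpos_of_nonneg_of_nonpos (by positivity) (by linarith)

/-! ### The Markov chain of the pairs `(x_t, m_t)` -/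

instance {α : Type*} [MeasurableSpace α] (κ : Kernel α α) [IsMarkovKernel κ] (k : ℕ) :
    IsMarkovKernel (κ ^ k) := by
  induction k with
  | zero => rw [pow_zero]; exact inferInstanceAs (IsMarkovKernel Kernel.id)
  | succ k ih => rw [pow_succ']; exact inferInstanceAs (IsMarkovKernel (κ ∘ₖ (κ ^ k)))

/-- The law of the chain with kernel `κ` and initial law `ν`, one transition later. -/
lemma bind_pow_succ {α : Type*} [MeasurableSpace α] (κ : Kernel α α) (ν : Measure α) (k : ℕ) :
    ν.bind (κ ^ (k + 1)) = (ν.bind (κ ^ k)).bind κ := by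
  rw [pow_succ', Measure.bind_bind (Kernel.aemeasurable _) (Kernel.aemeasurable _)]
  rfl

lemma bind_pow_add {α : Type*} [MeasurableSpace α] (κ : Kernel α α) (ν : Measure α) (k j : ℕ) :
    ν.bind (κ ^ (k + j)) = (ν.bind (κ ^ k)).bind (κ ^ j) := by
  rw [add_comm, pow_add, Measure.bind_bind (Kernel.aemeasurable _) (Kernel.aemeasurable _)]
  rfl

lemma bind_pow_zero {α : Type*} [MeasurableSpace α] (κ : Kernel α α) (ν : Measure α) :
    ν.bind (κ ^ 0 : Kernel α α) = ν := by
  have h : ∀ a, (κ ^ 0 : Kernel α α) a = Measure.dirac a := fun a => by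
    rw [pow_zero]
    exact Kernel.id_apply a
  exact (Measure.bind_congr_right (ae_of_all _ h)).trans Measure.bind_dirac

instance {α : Type*} [MeasurableSpace α] (κ : Kernel α α) [IsMarkovKernel κ] (ν : Measure α)
    [IsProbabilityMeasure ν] (k : ℕ) : IsProbabilityMeasure (ν.bind (κ ^ k)) :=
  inferInstanceAs (IsProbabilityMeasure ((κ ^ k) ∘ₘ ν))

/-- Summing a Lyapunov drift condition along a Markov chain. -/
lemma sum_lintegral_le_of_drift {α : Type*} [MeasurableSpace α] (κ : Kernel α α) [IsMarkovKernel κ]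
    (ν : Measure α) [IsProbabilityMeasure ν] {V D : α → ℝ≥0∞} {e : ℝ≥0∞} (hV : Measurable V)
    (h : ∀ a, ∫⁻ b, V b ∂(κ a) + D a ≤ V a + e) (k : ℕ) :
    ∑ j ∈ Finset.range k, ∫⁻ a, D a ∂(ν.bind (κ ^ j)) + ∫⁻ a, V a ∂(ν.bind (κ ^ k))
      ≤ ∫⁻ a, V a ∂ν + k * e := by
  induction k with
  | zero =>
    rw [bind_pow_zero]
    simp
  | succ k ih =>
    have hstep : ∫⁻ a, V a ∂(ν.bind (κ ^ (k + 1))) + ∫⁻ a, D a ∂(ν.bind (κ ^ k))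
        ≤ ∫⁻ a, V a ∂(ν.bind (κ ^ k)) + e := by
      rw [bind_pow_succ, Measure.lintegral_bind (Kernel.aemeasurable _) hV.aemeasurable,
        ← lintegral_add_left hV.lintegral_kernel]
      refine (lintegral_mono h).trans ?_
      rw [lintegral_add_right _ measurable_const]
      simp
    rw [Finset.sum_range_succ]
    calc _ = ∑ j ∈ Finset.range k, ∫⁻ a, D a ∂(ν.bind (κ ^ j)) +
          (∫⁻ a, V a ∂(ν.bind (κ ^ (k + 1))) + ∫⁻ a, D a ∂(ν.bind (κ ^ k))) := by ring
      _ ≤ ∑ j ∈ Finset.range k, ∫⁻ a, D a ∂(ν.bind (κ ^ j)) +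
          (∫⁻ a, V a ∂(ν.bind (κ ^ k)) + e) := by gcongr
      _ ≤ ∫⁻ a, V a ∂ν + k * e + e := by rw [← add_assoc]; gcongr
      _ = _ := by push_cast; ring

/-- The joint law of the initial point and the first momentum vector. -/
def initStateLaw (O : Kernel (E n × E n) (E n)) (x₁ : E n) : Measure (E n × E n) :=
  (O (x₁, 0)).map fun g => (x₁, g)

lemma measurable_prodMk_const (x₁ : E n) : Measurable fun g : E n => (x₁, g) :=
  measurable_prodMk_left

instance (O : Kernel (E n × E n) (E n)) [IsMarkovKernel O] (x₁ : E n) :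
    IsProbabilityMeasure (initStateLaw O x₁) :=
  Measure.isProbabilityMeasure_map (measurable_prodMk_const x₁).aemeasurable

/-! ### The drift of the Lyapunov function -/

section Drift

variable {σ G : ℝ} {O : Kernel (E n × E n) (E n)} [IsMarkovKernel O] {p q β : ℝ}

lemma norm_sq_convexComb_le (m g : E n) (h0 : 0 ≤ β) (h1 : β ≤ 1) :
    ‖β • m + (1 - β) • g‖ ^ 2 ≤ β * ‖m‖ ^ 2 + (1 - β) * ‖g‖ ^ 2 := by
  rw [norm_add_sq_real, norm_smul, norm_smul, real_inner_smul_left, real_inner_smul_right,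
    Real.norm_of_nonneg h0, Real.norm_of_nonneg (sub_nonneg.2 h1)]
  have h := real_inner_le_norm m g
  nlinarith [mul_nonneg (mul_nonneg h0 (sub_nonneg.2 h1)) (sq_nonneg (‖m‖ - ‖g‖)),
    mul_le_mul_of_nonneg_left h (mul_nonneg h0 (sub_nonneg.2 h1))]

lemma lintegral_enorm_sq_stepKernel_le (hO : IsStochasticOracle f σ O) (hf : LipschitzWith L f)
    (hG : G ^ 2 = (L : ℝ) ^ 2 + σ ^ 2) (h0 : 0 ≤ β) (h1 : β ≤ 1) (z : E n × E n) :
    ∫⁻ w, ‖w.2‖ₑ ^ 2 ∂(stepKernel O p q β z)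
      ≤ ENNReal.ofReal β * ‖z.2‖ₑ ^ 2 + ENNReal.ofReal (1 - β) * ENNReal.ofReal (G ^ 2) := by
  rw [lintegral_stepKernel _ _ _ _ _ (by fun_prop)]
  have hpt : ∀ g : E n, ‖β • z.2 + (1 - β) • g‖ₑ ^ 2
      ≤ ENNReal.ofReal β * ‖z.2‖ₑ ^ 2 + ENNReal.ofReal (1 - β) * ‖g‖ₑ ^ 2 := by
    intro g
    have h1' := sub_nonneg.2 h1
    simp_rw [enorm_sq_eq_ofReal]
    rw [← ENNReal.ofReal_mul h0, ← ENNReal.ofReal_mul h1',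
      ← ENNReal.ofReal_add (by positivity) (by positivity)]
    exact ENNReal.ofReal_le_ofReal (norm_sq_convexComb_le _ _ h0 h1)
  refine (lintegral_mono hpt).trans ?_
  rw [lintegral_add_left measurable_const,
    lintegral_const_mul (ENNReal.ofReal (1 - β)) (by fun_prop)]
  simp only [lintegral_const, measure_univ, mul_one]
  gcongr
  rw [hG]
  exact lintegral_enorm_sq_gradKernel_le hO hf z

/-- Convexity of the square keeps the second moment of the momentum below that of the oracle. -/
lemma lintegral_enorm_sq_chain_le (hO : IsStochasticOracle f σ O) (hf : LipschitzWith L f)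
    (hG : G ^ 2 = (L : ℝ) ^ 2 + σ ^ 2) (h0 : 0 ≤ β) (h1 : β ≤ 1) (x₁ : E n) (k : ℕ) :
    ∫⁻ w, ‖w.2‖ₑ ^ 2 ∂((initStateLaw O x₁).bind (stepKernel O p q β ^ k))
      ≤ ENNReal.ofReal (G ^ 2) := by
  have hmeas : Measurable fun w : E n × E n => ‖w.2‖ₑ ^ 2 := by fun_prop
  induction k with
  | zero =>
    rw [bind_pow_zero, initStateLaw, lintegral_map hmeas (measurable_prodMk_const x₁), hG]
    exact hO.lintegral_enorm_sq_le hf _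
  | succ k ih =>
    rw [bind_pow_succ, Measure.lintegral_bind (Kernel.aemeasurable _) hmeas.aemeasurable]
    refine (lintegral_mono (lintegral_enorm_sq_stepKernel_le hO hf hG h0 h1)).trans ?_
    rw [lintegral_add_right _ measurable_const, lintegral_const_mul _ hmeas]
    simp only [lintegral_const, measure_univ, mul_one]
    calc _ ≤ ENNReal.ofReal β * ENNReal.ofReal (G ^ 2)
          + ENNReal.ofReal (1 - β) * ENNReal.ofReal (G ^ 2) := by gcongr
      _ = ENNReal.ofReal (G ^ 2) := by
        rw [← add_mul, ← ENNReal.ofReal_add h0 (sub_nonneg.2 h1)]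
        simp

/-- The second moment of the next momentum: the mixed term is the decrease of `f`. -/
lemma integral_norm_sq_le (hO : IsStochasticOracle f σ O) (hf : LipschitzWith L f)
    (hG : G ^ 2 = (L : ℝ) ^ 2 + σ ^ 2) {z : E n × E n}
    (hη : 0 < p * ‖z.2‖ + q) :
    Integrable (fun g => ‖β • z.2 + (1 - β) • g‖ ^ 2) (gradKernel O p q z) ∧
    ∫ g, ‖β • z.2 + (1 - β) • g‖ ^ 2 ∂(gradKernel O p q z)
      ≤ β ^ 2 * ‖z.2‖ ^ 2 + (1 - β) ^ 2 * G ^ 2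
        + 2 * β * (1 - β) * ((p * ‖z.2‖ + q) * (f z.1 - f (nextPoint p q z.1 z.2))) := by
  have hint := integrable_gradKernel (p := p) (q := q) hO hf z
  have h2 := lintegral_enorm_sq_gradKernel_le (p := p) (q := q) hO hf z
  have hmem := memLp_two_of_lintegral_enorm_sq_le h2
  have hsq : Integrable (fun g : E n => ‖g‖ ^ 2) (gradKernel O p q z) :=
    (memLp_two_iff_integrable_sq_norm hmem.1).1 hmem
  have hin : Integrable (fun g : E n => inner ℝ z.2 g) (gradKernel O p q z) :=
    hint.const_inner z.2
  have hexp : ∀ g : E n, ‖β • z.2 + (1 - β) • g‖ ^ 2 = β ^ 2 * ‖z.2‖ ^ 2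
      + 2 * β * (1 - β) * inner ℝ z.2 g + (1 - β) ^ 2 * ‖g‖ ^ 2 := by
    intro g
    rw [norm_add_sq_real, norm_smul, norm_smul, real_inner_smul_left, real_inner_smul_right,
      mul_pow, mul_pow, Real.norm_eq_abs, Real.norm_eq_abs, sq_abs, sq_abs]
    ring
  have hsqle : ∫ g, ‖g‖ ^ 2 ∂(gradKernel O p q z) ≤ G ^ 2 := by
    rw [integral_eq_lintegral_of_nonneg_ae (Eventually.of_forall fun _ => by positivity) hsq.1]
    refine ENNReal.toReal_le_of_le_ofReal (sq_nonneg G) ?_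
    simp_rw [← enorm_sq_eq_ofReal, hG]
    exact h2
  have hadd : Integrable (fun g : E n => β ^ 2 * ‖z.2‖ ^ 2 + 2 * β * (1 - β) * inner ℝ z.2 g)
      (gradKernel O p q z) := (integrable_const _).add (hin.const_mul _)
  simp_rw [hexp]
  refine ⟨hadd.add (hsq.const_mul _), ?_⟩
  rw [integral_add hadd (hsq.const_mul _), integral_add (integrable_const _) (hin.const_mul _),
    integral_const_mul (2 * β * (1 - β)),
    integral_const_mul ((1 - β) ^ 2),
    integral_inner hint, inner_integral_gradKernel hO hf hη]
  simp only [integral_const, probReal_univ, one_smul]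
  nlinarith [mul_le_mul_of_nonneg_left hsqle (sq_nonneg (1 - β))]

/-- The Lyapunov function of the chain: the potential of the momentum plus a multiple of the gap
`f - inf f`. -/
def lyapunov (f : E n → ℝ) (c C : ℝ) (z : E n × E n) : ℝ :=
  potential c ‖z.2‖ + C * (f z.1 - ⨅ x, f x)

lemma measurable_lyapunov (hf : LipschitzWith L f) (c C : ℝ) :
    Measurable (lyapunov (n := n) f c C) :=
  ((measurable_potential c).comp measurable_snd.norm).add
    (((hf.continuous.measurable.comp measurable_fst).sub_const _).const_mul C)

/-- The drift of the Lyapunov function. The parameter `s` linearizes the convex function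
`a ↦ a² / (a + c)` from below. -/
lemma lintegral_lyapunov_stepKernel_le (hO : IsStochasticOracle f σ O) (hf : LipschitzWith L f)
    (hb : BddBelow (range f)) (hG : G ^ 2 = (L : ℝ) ^ 2 + σ ^ 2) (h0 : 0 ≤ β) (h1 : β ≤ 1)
    (hp : 0 < p) {c s : ℝ} (hc : 0 < c) (hq : q = c * p) (hs0 : 0 ≤ s) (hs2 : s ≤ 2)
    (z : E n × E n) :
    ∫⁻ w, ENNReal.ofReal (lyapunov f c (2 * β * (1 - β) * p) w) ∂(stepKernel O p q β z)
        + ENNReal.ofReal ((1 - β ^ 2) * (2 * s - s ^ 2)) * ‖z.2‖ₑ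
      ≤ ENNReal.ofReal (lyapunov f c (2 * β * (1 - β) * p) z)
        + ENNReal.ofReal ((1 - β) ^ 2 * G ^ 2 / c + (1 - β ^ 2) * (s ^ 2 * c)) := by
  set C := 2 * β * (1 - β) * p with hC
  have h1' := sub_nonneg.2 h1
  have hβ2 : 0 ≤ 1 - β ^ 2 := by nlinarith
  have hC0 : 0 ≤ C := by positivity
  have hgap : ∀ x, 0 ≤ f x - ⨅ x, f x := fun x => sub_nonneg.2 (ciInf_le hb x)
  set a := ‖z.2‖ with ha
  have ha0 : 0 ≤ a := norm_nonneg _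
  have hac : 0 < a + c := by positivity
  have hη : 0 < p * a + q := by rw [hq]; positivity
  set x' := nextPoint p q z.1 z.2 with hx'
  obtain ⟨hint, hle⟩ := integral_norm_sq_le (β := β) hO hf hG hη
  rw [← ha, ← hx'] at hle
  have hlin : (1 - β ^ 2) * (2 * s - s ^ 2) * a
      ≤ (1 - β ^ 2) * (a ^ 2 / (a + c)) + (1 - β ^ 2) * (s ^ 2 * c) := by
    have : (2 * s - s ^ 2) * a ≤ a ^ 2 / (a + c) + s ^ 2 * c := by
      rw [← sub_le_iff_le_add, le_div_iff₀ hac]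
      nlinarith [sq_nonneg (a - s * (a + c))]
    nlinarith
  have hlyap : ∀ w : E n × E n, 0 ≤ lyapunov f c C w := fun w =>
    add_nonneg (potential_nonneg hc (norm_nonneg _)) (mul_nonneg hC0 (hgap _))
  rw [lintegral_stepKernel _ _ _ _ _ (measurable_lyapunov hf c C).ennreal_ofReal, ← hx']
  -- the integrand is bounded by its tangent in the square of the new momentum
  have htan : ∀ g : E n, lyapunov f c C (x', β • z.2 + (1 - β) • g)
      ≤ potential c a + C * (f x' - ⨅ x, f x)
        + (‖β • z.2 + (1 - β) • g‖ ^ 2 - a ^ 2) / (a + c) := by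
    intro g
    have := potential_le_tangent ha0 (norm_nonneg (β • z.2 + (1 - β) • g)) hc
    simp only [lyapunov]
    linarith
  have hdiv : Integrable (fun g : E n => (‖β • z.2 + (1 - β) • g‖ ^ 2 - a ^ 2) / (a + c))
      (gradKernel O p q z) := (hint.sub (integrable_const _)).div_const _
  have hint' : Integrable (fun g : E n => potential c a + C * (f x' - ⨅ x, f x)
      + (‖β • z.2 + (1 - β) • g‖ ^ 2 - a ^ 2) / (a + c)) (gradKernel O p q z) :=
    (integrable_const _).add hdiv
  have hval : ∫ g, (potential c a + C * (f x' - ⨅ x, f x)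
      + (‖β • z.2 + (1 - β) • g‖ ^ 2 - a ^ 2) / (a + c)) ∂(gradKernel O p q z)
      + (1 - β ^ 2) * (2 * s - s ^ 2) * a ≤ lyapunov f c C z
        + ((1 - β) ^ 2 * G ^ 2 / c + (1 - β ^ 2) * (s ^ 2 * c)) := by
    rw [integral_add (integrable_const _) hdiv,
      integral_div, integral_sub hint (integrable_const _)]
    simp only [integral_const, probReal_univ, one_smul, lyapunov, ← ha]
    have hdiv : (∫ g, ‖β • z.2 + (1 - β) • g‖ ^ 2 ∂(gradKernel O p q z) - a ^ 2) / (a + c)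
        ≤ -((1 - β ^ 2) * (a ^ 2 / (a + c))) + (1 - β) ^ 2 * G ^ 2 / c
          + C * (f z.1 - f x') := by
      have hGc : (1 - β) ^ 2 * G ^ 2 / (a + c) ≤ (1 - β) ^ 2 * G ^ 2 / c :=
        div_le_div_of_nonneg_left (by positivity) hc (by linarith)
      calc _ ≤ (β ^ 2 * a ^ 2 + (1 - β) ^ 2 * G ^ 2
            + 2 * β * (1 - β) * ((p * a + q) * (f z.1 - f x')) - a ^ 2) / (a + c) := by gcongr
        _ = -((1 - β ^ 2) * (a ^ 2 / (a + c))) + (1 - β) ^ 2 * G ^ 2 / (a + c)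
          + C * (f z.1 - f x') := by
          rw [hq, hC]
          field_simp
          ring
        _ ≤ _ := by gcongr
    linarith
  calc _ ≤ ∫⁻ g, ENNReal.ofReal (potential c a + C * (f x' - ⨅ x, f x)
      + (‖β • z.2 + (1 - β) • g‖ ^ 2 - a ^ 2) / (a + c)) ∂(gradKernel O p q z)
        + ENNReal.ofReal ((1 - β ^ 2) * (2 * s - s ^ 2)) * ‖z.2‖ₑ := by
        gcongr with g
        exact htan g
    _ = ENNReal.ofReal (∫ g, (potential c a + C * (f x' - ⨅ x, f x)
      + (‖β • z.2 + (1 - β) • g‖ ^ 2 - a ^ 2) / (a + c)) ∂(gradKernel O p q z)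
      + (1 - β ^ 2) * (2 * s - s ^ 2) * a) := by
        have hnn : ∀ g : E n, 0 ≤ potential c a + C * (f x' - ⨅ x, f x)
          + (‖β • z.2 + (1 - β) • g‖ ^ 2 - a ^ 2) / (a + c) := fun g => (hlyap _).trans (htan g)
        have hκ : 0 ≤ (1 - β ^ 2) * (2 * s - s ^ 2) := mul_nonneg hβ2 (by nlinarith)
        rw [← ofReal_integral_eq_lintegral_ofReal hint' (Eventually.of_forall hnn),
          ENNReal.ofReal_add (integral_nonneg hnn) (mul_nonneg hκ ha0), ENNReal.ofReal_mul hκ, ha,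
          ofReal_norm]
    _ ≤ ENNReal.ofReal (lyapunov f c C z
        + ((1 - β) ^ 2 * G ^ 2 / c + (1 - β ^ 2) * (s ^ 2 * c))) := ENNReal.ofReal_le_ofReal hval
    _ = _ := ENNReal.ofReal_add (hlyap z) (by positivity)

/-- The summed drift: a bound for the sum of the mean norms of the momentum vectors. -/
lemma sum_lintegral_enorm_chain_le (hO : IsStochasticOracle f σ O) (hf : LipschitzWith L f)
    (hb : BddBelow (range f)) (hG : G ^ 2 = (L : ℝ) ^ 2 + σ ^ 2) (h0 : 0 ≤ β) (h1 : β ≤ 1)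
    (hp : 0 < p) {c s Δ : ℝ} (hc : 0 < c) (hq : q = c * p) (hs0 : 0 ≤ s) (hs2 : s ≤ 2)
    {x₁ : E n} (hΔ : f x₁ - ⨅ x, f x ≤ Δ) (T : ℕ) :
    ENNReal.ofReal ((1 - β ^ 2) * (2 * s - s ^ 2)) * ∑ k ∈ Finset.range T,
        ∫⁻ w, ‖w.2‖ₑ ∂((initStateLaw O x₁).bind (stepKernel O p q β ^ k))
      ≤ ENNReal.ofReal (G ^ 2 / c + 2 * β * (1 - β) * p * Δ
        + T * ((1 - β) ^ 2 * G ^ 2 / c + (1 - β ^ 2) * (s ^ 2 * c))) := by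
  have h1' := sub_nonneg.2 h1
  have hβ2 : 0 ≤ 1 - β ^ 2 := by nlinarith
  have hC0 : 0 ≤ 2 * β * (1 - β) * p := by positivity
  have hΔ0 : 0 ≤ Δ := (sub_nonneg.2 (ciInf_le hb x₁)).trans hΔ
  have hdrift := sum_lintegral_le_of_drift (stepKernel O p q β) (initStateLaw O x₁)
    (measurable_lyapunov hf c (2 * β * (1 - β) * p)).ennreal_ofReal
    (lintegral_lyapunov_stepKernel_le hO hf hb hG h0 h1 hp hc hq hs0 hs2) T
  have hinit : ∫⁻ w, ENNReal.ofReal (lyapunov f c (2 * β * (1 - β) * p) w) ∂(initStateLaw O x₁)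
      ≤ ENNReal.ofReal (G ^ 2 / c + 2 * β * (1 - β) * p * Δ) := by
    rw [initStateLaw, lintegral_map (measurable_lyapunov hf c _).ennreal_ofReal
      (measurable_prodMk_const x₁)]
    have hpt : ∀ g : E n, ENNReal.ofReal (lyapunov f c (2 * β * (1 - β) * p) (x₁, g))
        ≤ ENNReal.ofReal c⁻¹ * ‖g‖ₑ ^ 2 + ENNReal.ofReal (2 * β * (1 - β) * p * Δ) := by
      intro g
      have := potential_le_tangent le_rfl (norm_nonneg g) hc
      rw [potential_zero] at this
      rw [enorm_sq_eq_ofReal, ← ENNReal.ofReal_mul (by positivity),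
        ← ENNReal.ofReal_add (by positivity) (by positivity)]
      refine ENNReal.ofReal_le_ofReal ?_
      simp only [lyapunov]
      have h3 := mul_le_mul_of_nonneg_left hΔ hC0
      have h4 : (‖g‖ ^ 2 - 0 ^ 2) / (0 + c) = c⁻¹ * ‖g‖ ^ 2 := by
        field_simp
        ring
      linarith
    refine (lintegral_mono hpt).trans ?_
    rw [lintegral_add_right _ measurable_const, lintegral_const_mul _ (by fun_prop),
      ENNReal.ofReal_add (by positivity) (by positivity), div_eq_inv_mul,
      ENNReal.ofReal_mul (p := c⁻¹) (by positivity)]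
    simp only [lintegral_const, measure_univ, mul_one]
    rw [hG]
    gcongr
    exact hO.lintegral_enorm_sq_le hf _
  rw [Finset.mul_sum]
  calc _ = ∑ k ∈ Finset.range T, ∫⁻ w, ENNReal.ofReal ((1 - β ^ 2) * (2 * s - s ^ 2)) * ‖w.2‖ₑ
        ∂((initStateLaw O x₁).bind (stepKernel O p q β ^ k)) := by
        refine Finset.sum_congr rfl fun k _ => ?_
        rw [lintegral_const_mul _ (by fun_prop)]
    _ ≤ _ := le_self_add.trans hdrift
    _ ≤ ENNReal.ofReal (G ^ 2 / c + 2 * β * (1 - β) * p * Δ)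
        + T * ENNReal.ofReal ((1 - β) ^ 2 * G ^ 2 / c + (1 - β ^ 2) * (s ^ 2 * c)) := by gcongr
    _ = _ := by
        rw [ENNReal.ofReal_add (p := G ^ 2 / c + 2 * β * (1 - β) * p * Δ) (by positivity)
          (by positivity), ENNReal.ofReal_mul (p := (T : ℝ)) (by positivity),
          ENNReal.ofReal_natCast]

end Drift

/-! ### The mean of the momentum and the Goldstein subdifferential -/

section MeanDecomposition

open scoped Pointwise

lemma lintegral_enorm_le_of_sq {α : Type*} [MeasurableSpace α] {μ : Measure α}
    [IsProbabilityMeasure μ] {h : α → E n} (hh : Measurable h) {G : ℝ} (hG : 0 ≤ G)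
    (h2 : ∫⁻ a, ‖h a‖ₑ ^ 2 ∂μ ≤ ENNReal.ofReal (G ^ 2)) :
    ∫⁻ a, ‖h a‖ₑ ∂μ ≤ ENNReal.ofReal G := by
  have h1 := eLpNorm_le_eLpNorm_of_exponent_le (μ := μ) (show (1 : ℝ≥0∞) ≤ 2 by norm_num)
    hh.aestronglyMeasurable
  have h3 : eLpNorm h 2 μ ^ 2 = ∫⁻ a, ‖h a‖ₑ ^ 2 ∂μ := by
    have := eLpNorm_nnreal_pow_eq_lintegral (f := h) (μ := μ) (p := 2) (by norm_num)
    simpa using this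
  rw [eLpNorm_one_eq_lintegral_enorm] at h1
  refine (ENNReal.pow_right_strictMono two_ne_zero).le_iff_le.1 ?_
  rw [← ENNReal.ofReal_pow hG]
  exact (pow_le_pow_left' h1 2).trans (h3.le.trans h2)

lemma dist_nextPoint_le {p q : ℝ} (hp : 0 < p) (hq : 0 ≤ q) (x m : E n) :
    dist (nextPoint p q x m) x ≤ 1 / p := by
  rw [dist_eq_norm, nextPoint, sub_sub_cancel_left, norm_neg, norm_smul, Real.norm_eq_abs,
    abs_of_nonneg (by positivity), one_div_mul_eq_div]
  refine div_le_of_le_mul₀ (by positivity) (by positivity) ?_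
  have : 1 / p * (p * ‖m‖ + q) = ‖m‖ + 1 / p * q := by field_simp
  rw [this]
  have : 0 ≤ 1 / p * q := by positivity
  linarith

/-- Under the law `ν` of a state `(x, m)`, the point `x` stays within distance `r` of `c`, and the
mean of `m` is `α a` plus `1 - α` times an element of the closed Goldstein subdifferential
at `c`. -/
structure MeanDecomposition (f : E n → ℝ) (δ : ℝ) (c a : E n) (α r : ℝ)
    (ν : Measure (E n × E n)) : Prop where
  near : ∀ᵐ z ∂ν, z.1 ∈ Metric.closedBall c r
  integrable : Integrable (fun z => z.2) ν
  mem : ∫ z, z.2 ∂ν - α • a ∈ (1 - α) • closure (goldstein f δ c)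

section Mean

variable {σ G : ℝ} {O : Kernel (E n × E n) (E n)} [IsMarkovKernel O] {p q β δ α r : ℝ} {c a : E n}
  {ν : Measure (E n × E n)} [IsProbabilityMeasure ν]

lemma norm_integral_gradKernel_le (hO : IsStochasticOracle f σ O) (hf : LipschitzWith L f)
    (z : E n × E n) : ‖∫ g, g ∂(gradKernel O p q z)‖ ≤ L := by
  rw [integral_gradKernel hO hf]
  refine (norm_integral_le_of_norm_le_const
    (Eventually.of_forall fun u => hO.norm_mean_le hf _)).trans ?_
  simp

lemma integral_stepKernel_snd (hO : IsStochasticOracle f σ O) (hf : LipschitzWith L f)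
    (z : E n × E n) :
    Integrable (fun w : E n × E n => w.2) (stepKernel O p q β z) ∧
    ∫ w, w.2 ∂(stepKernel O p q β z) = β • z.2 + (1 - β) • ∫ g, g ∂(gradKernel O p q z) := by
  have hint := integrable_gradKernel (p := p) (q := q) hO hf z
  have hm := (measurable_nextState_right p q β z).aemeasurable (μ := gradKernel O p q z)
  rw [stepKernel_apply, integral_map hm (by fun_prop), integrable_map_measure (by fun_prop) hm]
  have hint' : Integrable (fun g => (nextState p q β (z, g)).2) (gradKernel O p q z) :=
    (integrable_const (β • z.2)).add (hint.smul (1 - β))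
  refine ⟨hint', ?_⟩
  simp only [nextState]
  have h := integral_add (integrable_const (β • z.2)) (hint.smul (1 - β))
  simp only [Pi.smul_apply, integral_smul, integral_const, probReal_univ, one_smul] at h
  rwa [integral_smul] at h

/-- One iteration multiplies the weight of the fixed vector by `β` and moves the point by less than
`1 / p`. -/
lemma MeanDecomposition.bind_stepKernel (h : MeanDecomposition f δ c a α r ν)
    (hO : IsStochasticOracle f σ O) (hf : LipschitzWith L f)
    (h0 : 0 ≤ β) (h1 : β ≤ 1) (hα : α ≤ 1) (hp : 0 < p) (hq : 0 ≤ q)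
    (hr : r + 1 / p ≤ δ) :
    MeanDecomposition f δ c a (β * α) (r + 1 / p) (ν.bind (stepKernel O p q β)) := by
  have hp' : 0 ≤ 1 / p := by positivity
  have h1' := sub_nonneg.2 h1
  have hnear : ∀ᵐ z ∂ν, nextPoint p q z.1 z.2 ∈ Metric.closedBall c (r + 1 / p) := by
    filter_upwards [h.near] with z hz
    have h1 := dist_nextPoint_le hp hq z.1 z.2
    rw [Metric.mem_closedBall] at hz ⊢
    linarith [dist_triangle (nextPoint p q z.1 z.2) z.1 c]
  have hmean : StronglyMeasurable fun z => ∫ g, g ∂(gradKernel O p q z) :=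
    measurable_id.stronglyMeasurable.integral_kernel
  have hgint : Integrable (fun z => ∫ g, g ∂(gradKernel O p q z)) ν :=
    Integrable.of_bound hmean.aestronglyMeasurable (C := L)
      (Eventually.of_forall fun z => norm_integral_gradKernel_le hO hf z)
  have hint : Integrable (fun z : E n × E n => z.2) (ν.bind (stepKernel O p q β)) := by
    refine ⟨by fun_prop, ?_⟩
    rw [hasFiniteIntegral_iff_enorm, Measure.lintegral_bind (Kernel.aemeasurable _) (by fun_prop)]
    have hC : ∀ z, ∫⁻ w, ‖w.2‖ₑ ∂(stepKernel O p q β z) ≤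
        ‖β‖ₑ * ‖z.2‖ₑ + ‖1 - β‖ₑ * ENNReal.ofReal (√((L : ℝ) ^ 2 + σ ^ 2)) := by
      intro z
      rw [lintegral_stepKernel _ _ _ _ _ (by fun_prop)]
      calc _ ≤ ∫⁻ g, (‖β‖ₑ * ‖z.2‖ₑ + ‖1 - β‖ₑ * ‖g‖ₑ) ∂(gradKernel O p q z) := by
            gcongr with g
            refine (enorm_add_le _ _).trans ?_
            rw [enorm_smul, enorm_smul]
        _ = ‖β‖ₑ * ‖z.2‖ₑ + ‖1 - β‖ₑ * ∫⁻ g, ‖g‖ₑ ∂(gradKernel O p q z) := by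
            rw [lintegral_add_left measurable_const, lintegral_const_mul ‖1 - β‖ₑ (by fun_prop)]
            simp
        _ ≤ _ := by
            gcongr
            refine lintegral_enorm_le_of_sq measurable_id (by positivity) ?_
            rw [Real.sq_sqrt (by positivity)]
            exact lintegral_enorm_sq_gradKernel_le hO hf z
    refine (lintegral_mono hC).trans_lt ?_
    rw [lintegral_add_right _ measurable_const, lintegral_const_mul _ (by fun_prop)]
    refine ENNReal.add_lt_top.2 ⟨ENNReal.mul_lt_top enorm_lt_top h.integrable.2, ?_⟩
    simp only [lintegral_const, measure_univ, mul_one]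
    exact ENNReal.mul_lt_top enorm_lt_top ENNReal.ofReal_lt_top
  refine ⟨?_, hint, ?_⟩
  · refine Measure.ae_comp_of_ae_ae (κ := stepKernel O p q β)
      (measurable_fst Metric.isClosed_closedBall.measurableSet) ?_
    filter_upwards [hnear] with z hz
    rw [stepKernel_apply, ae_map_iff (measurable_nextState_right p q β z).aemeasurable
      (measurable_fst Metric.isClosed_closedBall.measurableSet)]
    exact Eventually.of_forall fun _ => hz
  · have hstep : ∫ z, z.2 ∂(ν.bind (stepKernel O p q β))
        = β • ∫ z, z.2 ∂ν + (1 - β) • ∫ z, (∫ g, g ∂(gradKernel O p q z)) ∂ν := by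
      have hint2 := hint
      rw [Measure.comp_eq_comp_const_apply] at hint2 ⊢
      rw [Kernel.integral_comp hint2, Kernel.const_apply]
      simp_rw [(integral_stepKernel_snd hO hf _).2]
      have h3 := integral_add (h.integrable.smul β) (hgint.smul (1 - β))
      simp only [Pi.smul_apply, integral_smul] at h3
      exact h3
    have hv : ∫ z, (∫ g, g ∂(gradKernel O p q z)) ∂ν ∈ closure (goldstein f δ c) := by
      refine (convex_convexHull ℝ _).closure.integral_mem isClosed_closure ?_ hgint
      filter_upwards [h.near, hnear] with z hz hz'
      exact integral_gradKernel_mem hO hf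
        (Metric.closedBall_subset_closedBall (by linarith) hz)
        (Metric.closedBall_subset_closedBall hr hz')
    have hsum : 1 - β * α = β * (1 - α) + (1 - β) := by ring
    have hconv : Convex ℝ (closure (goldstein f δ c)) := (convex_convexHull ℝ _).closure
    rw [hstep, hsum, hconv.add_smul
      (mul_nonneg h0 (sub_nonneg.2 hα)) h1', mul_smul]
    have : β • ∫ z, z.2 ∂ν + (1 - β) • ∫ z, (∫ g, g ∂(gradKernel O p q z)) ∂ν - (β * α) • a
        = β • (∫ z, z.2 ∂ν - α • a) + (1 - β) • ∫ z, (∫ g, g ∂(gradKernel O p q z)) ∂ν := by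
      rw [smul_sub, smul_smul]
      abel
    rw [this]
    exact add_mem_add (smul_mem_smul_set h.mem) (smul_mem_smul_set hv)

lemma MeanDecomposition.bind_stepKernel_pow (h : MeanDecomposition f δ c a α r ν)
    (hO : IsStochasticOracle f σ O) (hf : LipschitzWith L f)
    (h0 : 0 ≤ β) (h1 : β ≤ 1) (hα0 : 0 ≤ α) (hα : α ≤ 1) (hp : 0 < p) (hq : 0 ≤ q) (j : ℕ)
    (hr : r + j * (1 / p) ≤ δ) :
    MeanDecomposition f δ c a (β ^ j * α) (r + j * (1 / p))
      (ν.bind (stepKernel O p q β ^ j : Kernel _ _)) := by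
  have hp' : 0 ≤ 1 / p := by positivity
  induction j with
  | zero => rw [bind_pow_zero]; simpa using h
  | succ j ih =>
    push_cast at hr ⊢
    have h2 := (ih (by linarith)).bind_stepKernel hO hf h0 h1
      (mul_le_one₀ (pow_le_one₀ h0 h1) hα0 hα) hp hq (by linarith)
    rw [bind_pow_succ]
    convert h2 using 1 <;> ring

omit [IsProbabilityMeasure ν] in
/-- A small mean momentum certifies approximate stationarity. -/
lemma MeanDecomposition.infEDist_le (h : MeanDecomposition f δ c a α r ν) (hα0 : 0 ≤ α)
    (hα : α < 1) :
    Metric.infEDist 0 (goldstein f δ c)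
      ≤ (∫⁻ z, ‖z.2‖ₑ ∂ν + ENNReal.ofReal α * ‖a‖ₑ) / ENNReal.ofReal (1 - α) := by
  obtain ⟨v, hv, hv'⟩ := h.mem
  simp only at hv'
  rw [← Metric.infEDist_closure]
  refine (Metric.infEDist_le_edist_of_mem hv).trans ?_
  rw [edist_zero_left, ENNReal.le_div_iff_mul_le (by simp [hα]) (by simp)]
  calc ‖v‖ₑ * ENNReal.ofReal (1 - α) = ‖(1 - α) • v‖ₑ := by
        rw [enorm_smul, Real.enorm_of_nonneg (sub_nonneg.2 hα.le), mul_comm]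
    _ = ‖∫ z, z.2 ∂ν - α • a‖ₑ := by rw [hv']
    _ ≤ ‖∫ z, z.2 ∂ν‖ₑ + ‖α • a‖ₑ := enorm_sub_le
    _ ≤ _ := by
      rw [enorm_smul, Real.enorm_of_nonneg hα0]
      gcongr
      exact enorm_integral_le_lintegral_enorm _

omit [IsMarkovKernel O] in
lemma nonempty_goldstein (hO : IsStochasticOracle f σ O) (hδ : 0 ≤ δ) (x : E n) :
    (goldstein f δ x).Nonempty :=
  ⟨_, subset_convexHull ℝ _ (mem_biUnion (Metric.mem_closedBall_self hδ) (hO.mean_mem x 0))⟩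

/-- The distance to stationarity at the current point is controlled by the mean norm of the momentum
`j` iterations later, given the current state. -/
lemma infEDist_goldstein_le_of_state (hO : IsStochasticOracle f σ O) (hf : LipschitzWith L f)
    (h0 : 0 ≤ β) (h1 : β ≤ 1) (hp : 0 < p) (hq : 0 ≤ q) (hδ : 0 ≤ δ) (j : ℕ)
    (hj : j * (1 / p) ≤ δ) (hβj : β ^ j < 1) (z : E n × E n) :
    Metric.infEDist 0 (goldstein f δ z.1)
      ≤ (∫⁻ w, ‖w.2‖ₑ ∂((stepKernel O p q β ^ j) z) + ENNReal.ofReal (β ^ j) * ‖z.2‖ₑ)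
        / ENNReal.ofReal (1 - β ^ j) := by
  have hbase : MeanDecomposition f δ z.1 z.2 1 0 (Measure.dirac z) := by
    refine ⟨?_, integrable_dirac (by simp), ?_⟩
    · rw [ae_dirac_eq]
      simp
    · rw [integral_dirac, one_smul, sub_self, sub_self,
        zero_smul_set (nonempty_goldstein hO hδ z.1).closure]
      exact Set.zero_mem_zero
  have h := hbase.bind_stepKernel_pow hO hf h0 h1 zero_le_one le_rfl hp hq j (by simpa using hj)
  rw [mul_one, Measure.dirac_bind (Kernel.measurable _)] at h
  exact h.infEDist_le (pow_nonneg h0 j) hβj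

/-- The distance to stationarity at the initial point is controlled by the mean norm of each of the
first momentum vectors; no initial term remains because the first answer is itself centred at a
generalized gradient. -/
lemma infEDist_goldstein_init_le (hO : IsStochasticOracle f σ O) (hf : LipschitzWith L f)
    (h0 : 0 ≤ β) (h1 : β ≤ 1) (hp : 0 < p) (hq : 0 ≤ q) (hδ : 0 ≤ δ) (x₁ : E n) (j : ℕ)
    (hj : j * (1 / p) ≤ δ) :
    Metric.infEDist 0 (goldstein f δ x₁)
      ≤ ∫⁻ w, ‖w.2‖ₑ ∂((initStateLaw O x₁).bind (stepKernel O p q β ^ j)) := by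
  have hm := (measurable_prodMk_const x₁).aemeasurable (μ := O (x₁, 0))
  have hbase : MeanDecomposition f δ x₁ 0 0 0 (initStateLaw O x₁) := by
    refine ⟨?_, ?_, ?_⟩
    · rw [initStateLaw, ae_map_iff hm (measurable_fst Metric.isClosed_closedBall.measurableSet)]
      simp
    · rw [initStateLaw, integrable_map_measure (by fun_prop) hm]
      obtain ⟨-, -, -, hint, -⟩ := hO x₁ 0
      exact hint
    · rw [initStateLaw, integral_map hm (by fun_prop), smul_zero, sub_zero, sub_zero, one_smul]
      exact subset_closure (subset_convexHull ℝ _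
        (mem_biUnion (Metric.mem_closedBall_self hδ) (hO.mean_mem x₁ 0)))
  have h := hbase.bind_stepKernel_pow hO hf h0 h1 le_rfl zero_le_one hp hq j (by simpa using hj)
  rw [mul_zero] at h
  simpa using h.infEDist_le le_rfl zero_lt_one

/-- Markov's inequality for the distance to stationarity of the point `K` iterations earlier (or of
the initial point). Here `k - K` is truncated. -/
lemma measure_le_infEDist_le (hO : IsStochasticOracle f σ O) (hf : LipschitzWith L f)
    (hG : G ^ 2 = (L : ℝ) ^ 2 + σ ^ 2) (hG0 : 0 ≤ G)
    (h0 : 0 ≤ β) (h1 : β ≤ 1) (hp : 0 < p) (hq : 0 ≤ q) (hδ : 0 ≤ δ) {K : ℕ}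
    (hK : K * (1 / p) ≤ δ) (hβK : β ^ K < 1) {ε : ℝ} (hε : 0 < ε) (x₁ : E n) (k : ℕ) :
    ((initStateLaw O x₁).bind (stepKernel O p q β ^ (k - K)))
        {z | ENNReal.ofReal ε ≤ Metric.infEDist 0 (goldstein f δ z.1)}
      ≤ (∫⁻ w, ‖w.2‖ₑ ∂((initStateLaw O x₁).bind (stepKernel O p q β ^ k))
          + ENNReal.ofReal (β ^ K) * ENNReal.ofReal G)
        / ENNReal.ofReal (1 - β ^ K) / ENNReal.ofReal ε := by
  have hε0 : ENNReal.ofReal ε ≠ 0 := by simp [hε]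
  have hmeas : Measurable fun w : E n × E n => ‖w.2‖ₑ := by fun_prop
  have hp' : 0 ≤ 1 / p := by positivity
  rcases le_or_gt K k with hk | hk
  · set μ := (initStateLaw O x₁).bind (stepKernel O p q β ^ (k - K)) with hμ
    have hΦ : Measurable fun z : E n × E n =>
        (∫⁻ w, ‖w.2‖ₑ ∂((stepKernel O p q β ^ K) z) + ENNReal.ofReal (β ^ K) * ‖z.2‖ₑ)
          / ENNReal.ofReal (1 - β ^ K) :=
      (hmeas.lintegral_kernel.add (hmeas.const_mul _)).div_const _
    refine (measure_mono fun z hz => le_trans hz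
      (infEDist_goldstein_le_of_state hO hf h0 h1 hp hq hδ K hK hβK z)).trans
      ((meas_ge_le_lintegral_div hΦ.aemeasurable hε0 ENNReal.ofReal_ne_top).trans ?_)
    gcongr
    simp_rw [div_eq_mul_inv]
    rw [lintegral_mul_const _ (by fun_prop), lintegral_add_left hmeas.lintegral_kernel,
      lintegral_const_mul _ hmeas]
    have hk' : (initStateLaw O x₁).bind (stepKernel O p q β ^ k)
        = μ.bind (stepKernel O p q β ^ K) := by
      rw [hμ, ← bind_pow_add, Nat.sub_add_cancel hk]
    rw [hk', Measure.lintegral_bind (m := μ) (μ := stepKernel O p q β ^ K)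
      (Kernel.aemeasurable _) hmeas.aemeasurable]
    refine mul_le_mul' (add_le_add le_rfl (mul_le_mul' le_rfl ?_)) le_rfl
    exact lintegral_enorm_le_of_sq measurable_snd hG0
      (lintegral_enorm_sq_chain_le hO hf hG h0 h1 x₁ (k - K))
  · have hinit : ∀ᵐ z ∂(initStateLaw O x₁), z.1 = x₁ := by
      rw [initStateLaw, ae_map_iff (measurable_prodMk_const x₁).aemeasurable
        (measurableSet_eq_fun measurable_fst measurable_const)]
      simp
    rw [Nat.sub_eq_zero_of_le hk.le, bind_pow_zero]
    have hset : (initStateLaw O x₁)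
          {z | ENNReal.ofReal ε ≤ Metric.infEDist 0 (goldstein f δ z.1)}
        = (initStateLaw O x₁)
          {_z | ENNReal.ofReal ε ≤ Metric.infEDist 0 (goldstein f δ x₁)} := by
      refine measure_congr ?_
      filter_upwards [hinit] with z hz
      simp only [eq_iff_iff]
      change (_ ≤ Metric.infEDist 0 (goldstein f δ z.1)) ↔ _
      rw [hz]
      rfl
    rw [hset]
    refine (meas_ge_le_lintegral_div (f := fun _ => Metric.infEDist 0 (goldstein f δ x₁))
      aemeasurable_const hε0 ENNReal.ofReal_ne_top).trans ?_
    simp only [lintegral_const, measure_univ, mul_one]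
    gcongr
    have hkK : (k : ℝ) * (1 / p) ≤ K * (1 / p) := by gcongr
    refine (infEDist_goldstein_init_le hO hf h0 h1 hp hq hδ x₁ k (hkK.trans hK)).trans ?_
    rw [ENNReal.le_div_iff_mul_le (by simp [hβK]) (by simp)]
    calc _ ≤ (∫⁻ w, ‖w.2‖ₑ ∂((initStateLaw O x₁).bind (stepKernel O p q β ^ k))) * 1 := by
          gcongr
          rw [ENNReal.ofReal_le_one]
          linarith [pow_nonneg h0 K]
      _ ≤ _ := by rw [mul_one]; exact le_self_add

end Mean

end MeanDecomposition

/-! ### From the record of the run to the Markov chain -/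

/-- The state `(x_t, m_t)` stored in a record. -/
def state (t : ℕ) (s : Run n) : E n × E n := (s.1 t, s.2.1 t)

lemma measurable_state (t : ℕ) : Measurable (state (n := n) t) :=
  ((measurable_pi_apply t).comp measurable_fst).prodMk
    ((measurable_pi_apply t).comp (measurable_fst.comp measurable_snd))

/-- The record after iteration `t`, given the record before it and the oracle's answer. -/
def extend (p q β : ℝ) (t : ℕ) (s : Run n) (g : E n) : Run n :=
  (Function.update s.1 (t + 1) (nextPoint p q (s.1 t) (s.2.1 t)),
    Function.update s.2.1 (t + 1) (β • s.2.1 t + (1 - β) • g), s.2.2 + 1)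

lemma measurable_extend (p q β : ℝ) (t : ℕ) (s : Run n) : Measurable (extend p q β t s) := by
  refine measurable_const.prodMk (Measurable.prodMk ?_ measurable_const)
  exact (measurable_update _).comp
    (measurable_const.add (measurable_id.const_smul (1 - β)))

lemma state_extend_succ (p q β : ℝ) (t : ℕ) (s : Run n) (g : E n) :
    state (t + 1) (extend p q β t s g) = nextState p q β (state t s, g) := by
  simp [state, extend, nextState]

lemma state_extend_of_ne (p q β : ℝ) {t r : ℕ} (h : r ≠ t + 1) (s : Run n) (g : E n) :
    state r (extend p q β t s g) = state r s := by
  simp [state, extend, Function.update_of_ne h]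

section RunLaw

variable (O : Kernel (E n × E n) (E n)) [IsMarkovKernel O] (p q β : ℝ)

omit [IsMarkovKernel O] in
lemma stepLaw_eq_map (t : ℕ) (s : Run n) :
    stepLaw O p q β t s = (gradKernel O p q (state t s)).map (extend p q β t s) := by
  have hN := measurable_extend p q β t s
  have hQ : Measurable fun u => query p q (state t s, u) :=
    (measurable_query p q).comp measurable_prodMk_left
  have hstep : stepLaw O p q β t s = (volume.restrict (Icc (0 : ℝ) 1)).bind fun u =>
      (O (query p q (state t s, u))).map (extend p q β t s) := by
    simp_rw [← Measure.bind_dirac_eq_map _ hN]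
    rfl
  rw [hstep]
  ext A hA
  rw [Measure.bind_apply hA, Measure.map_apply hN hA, gradKernel,
    Kernel.comp_apply' _ _ _ (hN hA), queryKernel_apply,
    lintegral_map (Kernel.measurable_coe _ (hN hA)) hQ]
  · simp_rw [Measure.map_apply hN hA]
  · exact ((Measure.measurable_map _ hN).comp (O.measurable.comp hQ)).aemeasurable

omit [IsMarkovKernel O] in
lemma lintegral_stepLaw (t : ℕ) (s : Run n) {h : Run n → ℝ≥0∞} (hh : Measurable h) :
    ∫⁻ s', h s' ∂(stepLaw O p q β t s)
      = ∫⁻ g, h (extend p q β t s g) ∂(gradKernel O p q (state t s)) := by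
  rw [stepLaw_eq_map, lintegral_map hh (measurable_extend p q β t s)]

lemma lintegral_runLaw_succ (x₁ : E n) (T : ℕ) {h : Run n → ℝ≥0∞} (hh : Measurable h) :
    ∫⁻ s, h s ∂(runLaw O x₁ p q β (T + 1))
      = ∫⁻ s, ∫⁻ g, h (extend p q β (T + 1) s g) ∂(gradKernel O p q (state (T + 1) s))
          ∂(runLaw O x₁ p q β T) := by
  rw [runLaw, Measure.lintegral_bind (measurable_stepLaw O p q β (T + 1)).1.aemeasurable
    hh.aemeasurable]
  simp_rw [lintegral_stepLaw O p q β (T + 1) _ hh]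

omit [IsMarkovKernel O] in
lemma initLaw_eq_map (x₁ : E n) :
    initLaw O x₁ = (O (x₁, 0)).map fun g =>
      ((Function.update 0 1 x₁, Function.update 0 1 g, 1) : Run n) :=
  Measure.bind_dirac_eq_map _
    (measurable_const.prodMk ((measurable_update _).prodMk measurable_const))

/-- In the record of the run, the states form the Markov chain with kernel `stepKernel`. -/
lemma lintegral_state_runLaw (x₁ : E n) (T : ℕ) {k : ℕ} (hk : k ≤ T) {h : E n × E n → ℝ≥0∞}
    (hh : Measurable h) :
    ∫⁻ s, h (state (k + 1) s) ∂(runLaw O x₁ p q β T)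
      = ∫⁻ z, h z ∂((initStateLaw O x₁).bind (stepKernel O p q β ^ k)) := by
  have hms : ∀ {h : E n × E n → ℝ≥0∞}, Measurable h → ∀ t,
      Measurable fun s : Run n => h (state t s) := fun hh t => hh.comp (measurable_state t)
  induction T generalizing k h with
  | zero =>
    obtain rfl := Nat.le_zero.1 hk
    rw [bind_pow_zero, runLaw, initLaw_eq_map, initStateLaw,
      lintegral_map hh (measurable_prodMk_const x₁),
      lintegral_map (hms hh _)]
    · simp [state]
    · exact measurable_const.prodMk ((measurable_update _).prodMk measurable_const)
  | succ T ih =>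
    rw [lintegral_runLaw_succ _ _ _ _ _ _ (hms hh _)]
    rcases hk.lt_or_eq with hk' | rfl
    · have hne : k + 1 ≠ T + 1 + 1 := by omega
      simp_rw [state_extend_of_ne p q β hne]
      simp only [lintegral_const, measure_univ, mul_one]
      exact ih (Nat.lt_succ_iff.1 hk') hh
    · simp_rw [state_extend_succ]
      have h1 : ∀ s : Run n, ∫⁻ g, h (nextState p q β (state (T + 1) s, g))
          ∂(gradKernel O p q (state (T + 1) s))
          = ∫⁻ w, h w ∂(stepKernel O p q β (state (T + 1) s)) := fun s =>
        (lintegral_stepKernel O p q β _ hh).symm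
      simp_rw [h1]
      rw [ih le_rfl hh.lintegral_kernel, bind_pow_succ,
        Measure.lintegral_bind (Kernel.aemeasurable _) hh.aemeasurable]

lemma ae_count_runLaw (x₁ : E n) (T : ℕ) : ∀ᵐ s ∂(runLaw O x₁ p q β T), s.2.2 = T + 1 := by
  have hm : ∀ T : ℕ, MeasurableSet {s : Run n | s.2.2 = T + 1} := fun T =>
    (measurable_snd.comp measurable_snd) (measurableSet_singleton (T + 1))
  induction T with
  | zero =>
    rw [runLaw, initLaw_eq_map, ae_map_iff (measurable_const.prodMk
      ((measurable_update _).prodMk measurable_const)).aemeasurable (hm 0)]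
    simp
  | succ T ih =>
    refine Measure.ae_comp_of_ae_ae
      (κ := ⟨stepLaw O p q β (T + 1), (measurable_stepLaw O p q β (T + 1)).1⟩) (hm (T + 1)) ?_
    filter_upwards [ih] with s hs
    change ∀ᵐ s' ∂(stepLaw O p q β (T + 1) s), _
    rw [stepLaw_eq_map, ae_map_iff (measurable_extend p q β _ s).aemeasurable (hm (T + 1))]
    simp [extend, hs]

lemma lintegral_uniformOn_Icc (T : ℕ) (h : ℕ → ℝ≥0∞) :
    ∫⁻ i, h i ∂(uniformOn (Icc 1 T)) = (T : ℝ≥0∞)⁻¹ * ∑ k ∈ Finset.range T, h (k + 1) := by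
  have hc : Measure.count (Icc 1 T) = T := by
    rw [← Finset.coe_Icc, Measure.count_apply_finset]
    simp
  have hs : ∫⁻ i in Icc 1 T, h i ∂Measure.count = ∑ k ∈ Finset.range T, h (k + 1) := by
    rw [← Finset.coe_Icc, lintegral_finset, ← Finset.Ico_succ_right_eq_Icc,
      Finset.sum_Ico_eq_sum_range]
    simp [add_comm]
  rw [uniformOn, ProbabilityTheory.cond, lintegral_smul_measure, hc, hs, smul_eq_mul]

omit [IsMarkovKernel O] in
/-- The law of the output is the average over `i = k + 1` of the laws of the `i`-th candidates. -/
lemma stochINGD_apply (x₁ : E n) {T : ℕ} (hT : 1 ≤ T) (K : ℕ) {S : Set (E n × ℕ)}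
    (hS : MeasurableSet S) :
    stochINGD O x₁ p q β T K S = (T : ℝ≥0∞)⁻¹ * ∑ k ∈ Finset.range T,
      runLaw O x₁ p q β T {s | (s.1 (k - K + 1), s.2.2) ∈ S} := by
  have : IsProbabilityMeasure (uniformOn (Icc 1 T)) :=
    isProbabilityMeasure_uniformOn (finite_Icc 1 T) (nonempty_Icc.2 hT)
  have hN0 : ∀ j : ℕ, Measurable fun s : Run n => ((s.1 j, s.2.2) : E n × ℕ) := fun j =>
    ((measurable_pi_apply j).comp measurable_fst).prodMk (measurable_snd.comp measurable_snd)
  have hN : Measurable fun z : Run n × ℕ => ((z.1.1 (max (z.2 - K) 1), z.1.2.2) : E n × ℕ) :=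
    measurable_from_prod_countable_left fun i => hN0 (max (i - K) 1)
  have hB := (measurable_bind_kernel (Kernel.const (Run n) (uniformOn (Icc 1 T)))
    (fun s i => Measure.dirac ((s.1 (max (i - K) 1), s.2.2) : E n × ℕ))
    (Measure.measurable_dirac.comp hN) fun _ _ => Measure.dirac.isProbabilityMeasure).1
  simp only [Kernel.const_apply] at hB
  rw [stochINGD, Measure.bind_apply hS hB.aemeasurable]
  have hin : ∀ s : Run n, ((uniformOn (Icc 1 T)).bind fun i =>
      Measure.dirac ((s.1 (max (i - K) 1), s.2.2) : E n × ℕ)) S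
      = (T : ℝ≥0∞)⁻¹ * ∑ k ∈ Finset.range T,
        {s : Run n | (s.1 (k - K + 1), s.2.2) ∈ S}.indicator 1 s := by
    intro s
    rw [Measure.bind_apply hS (measurable_of_countable _).aemeasurable, lintegral_uniformOn_Icc]
    congr 1
    refine Finset.sum_congr rfl fun k _ => ?_
    rw [show max (k + 1 - K) 1 = k - K + 1 by omega, Measure.dirac_apply' _ hS]
    rfl
  simp_rw [hin]
  have hmeas : ∀ k : ℕ, MeasurableSet {s : Run n | (s.1 (k - K + 1), s.2.2) ∈ S} := fun k =>
    hN0 _ hS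
  rw [lintegral_const_mul _ (Finset.measurable_sum _ fun k _ =>
    measurable_one.indicator (hmeas k)),
    lintegral_finsetSum _ fun k _ => measurable_one.indicator (hmeas k)]
  congr 1
  exact Finset.sum_congr rfl fun k _ => lintegral_indicator_one (hmeas k)

end RunLaw

/-! ### The choice of the parameters -/

section Parameters

variable {G ε δ Δ β p : ℝ} {K T : ℕ}

lemma two_le_log (hε : 0 < ε) (hεG : ε ≤ G) : 2 ≤ Real.log (16 * G / ε) := by
  have h1 : (2 : ℝ) ^ 4 ≤ 16 * G / ε := by
    rw [le_div_iff₀ hε]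
    linarith
  have h2 := Real.log_le_log (by norm_num) h1
  rw [Real.log_pow] at h2
  have := Real.log_two_gt_d9
  push_cast at h2
  linarith

lemma sq_div_le (hε : 0 < ε) (hεG : ε ≤ G) : ε ^ 2 / (64 * G ^ 2) ≤ 1 / 64 := by
  have hG : 0 < G := hε.trans_le hεG
  rw [div_le_div_iff₀ (by positivity) (by norm_num)]
  nlinarith

lemma momentum_weight_mem (hε : 0 < ε) (hεG : ε ≤ G) (hβ : β = 1 - ε ^ 2 / (64 * G ^ 2)) :
    0 ≤ β ∧ β < 1 := by
  have hG : 0 < G := hε.trans_le hεG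
  have h1 := sq_div_le hε hεG
  have h2 : 0 < ε ^ 2 / (64 * G ^ 2) := by positivity
  constructor <;> linarith

/-- The forgetting factor over `K` iterations; the constant `16` inside the logarithm makes it
smaller than `ε / (15 G)`. -/
lemma pow_floor_le (hε : 0 < ε) (hεG : ε ≤ G) (hδ : 0 < δ)
    (hβ : β = 1 - ε ^ 2 / (64 * G ^ 2))
    (hp : p = 64 * G ^ 2 * Real.log (16 * G / ε) / (δ * ε ^ 2)) (hK : K = ⌊p * δ⌋₊) :
    β ^ K ≤ ε / (15 * G) := by
  have hG : 0 < G := hε.trans_le hεG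
  set w := ε ^ 2 / (64 * G ^ 2) with hw
  have hw0 : 0 < w := by positivity
  have hw1 : w ≤ 1 / 64 := sq_div_le hε hεG
  have hwp : w * (p * δ) = Real.log (16 * G / ε) := by
    rw [hw, hp]
    field_simp
  have hKp : p * δ - 1 ≤ K := by
    rw [hK]
    exact (Nat.sub_one_lt_floor _).le
  have hexp : Real.exp w ≤ 16 / 15 := by
    have h1 := Real.add_one_le_exp (-w)
    rw [Real.exp_neg] at h1
    have h2 := Real.exp_pos w
    rw [← one_div, le_div_iff₀ h2] at h1
    nlinarith
  calc β ^ K ≤ Real.exp (-w) ^ K := by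
        refine pow_le_pow_left₀ (by rw [hβ]; linarith) ?_ K
        rw [hβ]
        linarith [Real.add_one_le_exp (-w)]
    _ = Real.exp (-(w * K)) := by
        rw [← Real.exp_nat_mul]
        ring_nf
    _ ≤ Real.exp (-Real.log (16 * G / ε) + w) := by
        refine Real.exp_le_exp.2 ?_
        nlinarith
    _ = ε / (16 * G) * Real.exp w := by
        rw [Real.exp_add, Real.exp_neg, Real.exp_log (by positivity), inv_div]
    _ ≤ ε / (16 * G) * (16 / 15) := by gcongr
    _ = ε / (15 * G) := by
        field_simp

lemma floor_mul_le (hp : 0 < p) (hδ : 0 < δ) (hK : K = ⌊p * δ⌋₊) : K * (1 / p) ≤ δ := by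
  rw [mul_one_div, div_le_iff₀ hp, hK, mul_comm δ p]
  exact Nat.floor_le (by positivity)

/-- The two lower bounds for the number of iterations, one for each argument of the maximum. -/
lemma lower_bounds_iterations (hε : 0 < ε) (hεG : ε ≤ G) (hδ : 0 < δ) (hΔ : 0 < Δ) :
    2 ^ 16 * G ^ 3 * Δ * Real.log (16 * G / ε) / (ε ^ 4 * δ) ≤
      2 ^ 16 * G ^ 3 * Δ * Real.log (16 * G / ε) / (ε ^ 4 * δ) * max 1 (G * δ / (8 * Δ)) ∧
    2 ^ 14 * G ^ 4 / ε ^ 4 ≤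
      2 ^ 16 * G ^ 3 * Δ * Real.log (16 * G / ε) / (ε ^ 4 * δ) * max 1 (G * δ / (8 * Δ)) := by
  have hG : 0 < G := hε.trans_le hεG
  have hl := two_le_log hε hεG
  set l := Real.log (16 * G / ε)
  have hl0 : 0 < l := by linarith
  have hX : 0 < 2 ^ 16 * G ^ 3 * Δ * l / (ε ^ 4 * δ) := by positivity
  refine ⟨le_mul_of_one_le_right hX.le (le_max_left _ _), ?_⟩
  calc 2 ^ 14 * G ^ 4 / ε ^ 4 ≤ 2 ^ 13 * G ^ 4 * l / ε ^ 4 := by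
        refine div_le_div_of_nonneg_right ?_ (by positivity)
        nlinarith [pow_pos hG 4]
    _ = 2 ^ 16 * G ^ 3 * Δ * l / (ε ^ 4 * δ) * (G * δ / (8 * Δ)) := by
        field_simp
        norm_num
    _ ≤ _ := by
        gcongr
        exact le_max_right _ _

lemma ceil_add_one_le (hε : 0 < ε) (hεG : ε ≤ G) (hδ : 0 < δ) (hΔ : 0 < Δ)
    (hT : T = ⌈2 ^ 16 * G ^ 3 * Δ * Real.log (16 * G / ε) / (ε ^ 4 * δ)
      * max 1 (G * δ / (8 * Δ))⌉₊) :
    (T : ℝ) + 1 ≤ 2 ^ 17 * (G ^ 3 * Δ / (ε ^ 4 * δ)) * Real.log (16 * G / ε)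
        * max 1 (G * δ / (8 * Δ)) := by
  have hG : 0 < G := hε.trans_le hεG
  have h2 := (lower_bounds_iterations hε hεG hδ hΔ).2
  set X := 2 ^ 16 * G ^ 3 * Δ * Real.log (16 * G / ε) / (ε ^ 4 * δ)
    * max 1 (G * δ / (8 * Δ)) with hX
  have h3 : 2 ≤ X := by
    refine le_trans ?_ h2
    rw [le_div_iff₀ (by positivity)]
    have : ε ^ 4 ≤ G ^ 4 := by gcongr
    linarith [pow_pos hG 4]
  have h4 : (T : ℝ) < X + 1 := hT ▸ Nat.ceil_lt_add_one (by linarith)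
  have h5 : 2 ^ 17 * (G ^ 3 * Δ / (ε ^ 4 * δ)) * Real.log (16 * G / ε)
        * max 1 (G * δ / (8 * Δ)) = 2 * X := by
    rw [hX]
    ring
  rw [h5]
  linarith

/-- With the chosen parameters the summed drift yields the average `ε / 8` for the mean norms of the
momentum. The slope is taken at `s = ε / (32 G)`, close to the best choice. -/
lemma drift_bound (hε : 0 < ε) (hεG : ε ≤ G) (hδ : 0 < δ) (hΔ : 0 < Δ)
    (hβ : β = 1 - ε ^ 2 / (64 * G ^ 2))
    (hp : p = 64 * G ^ 2 * Real.log (16 * G / ε) / (δ * ε ^ 2))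
    (hT : T = ⌈2 ^ 16 * G ^ 3 * Δ * Real.log (16 * G / ε) / (ε ^ 4 * δ)
      * max 1 (G * δ / (8 * Δ))⌉₊) :
    G ^ 2 / (4 * G) + 2 * β * (1 - β) * p * Δ
        + T * ((1 - β) ^ 2 * G ^ 2 / (4 * G) + (1 - β ^ 2) * ((ε / (32 * G)) ^ 2 * (4 * G)))
      ≤ (1 - β ^ 2) * (2 * (ε / (32 * G)) - (ε / (32 * G)) ^ 2) * (T * (ε / 8)) := by
  have hG : 0 < G := hε.trans_le hεG
  have hl := two_le_log hε hεG
  obtain ⟨hX1, hX2⟩ := lower_bounds_iterations hε hεG hδ hΔ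
  set l := Real.log (16 * G / ε)
  have hTX := Nat.le_ceil (2 ^ 16 * G ^ 3 * Δ * l / (ε ^ 4 * δ) * max 1 (G * δ / (8 * Δ)))
  rw [← hT] at hTX
  have hT1 := hX1.trans hTX
  have hT2 := hX2.trans hTX
  -- everything is expressed through the ratio `x = ε / G`
  obtain ⟨x, rfl⟩ : ∃ x, ε = x * G := ⟨ε / G, by field_simp⟩
  have hx0 : 0 < x := pos_of_mul_pos_left hε hG.le
  have hx1 : x ≤ 1 := by
    by_contra! h
    nlinarith
  have hβ' : β = 1 - x ^ 2 / 64 := by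
    rw [hβ]
    field_simp
  have hs : x * G / (32 * G) = x / 32 := by field_simp
  have hwp : (1 - β) * p = l / δ := by
    rw [hβ', hp]
    field_simp
    ring
  have hgap : l / δ * Δ ≤ T * G * x ^ 4 / 2 ^ 16 := by
    have h := mul_le_mul_of_nonneg_right hT1 (show 0 ≤ G * x ^ 4 / 2 ^ 16 by positivity)
    calc _ = 2 ^ 16 * G ^ 3 * Δ * l / ((x * G) ^ 4 * δ) * (G * x ^ 4 / 2 ^ 16) := by
          field_simp
      _ ≤ _ := h
      _ = _ := by ring
  have hinit : G / 4 ≤ T * G * x ^ 4 / 2 ^ 16 := by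
    have h := mul_le_mul_of_nonneg_right hT2 (show 0 ≤ G * x ^ 4 / 2 ^ 16 by positivity)
    calc _ = 2 ^ 14 * G ^ 4 / (x * G) ^ 4 * (G * x ^ 4 / 2 ^ 16) := by
          field_simp
          norm_num
      _ ≤ _ := h
      _ = _ := by ring
  have hβ1 : β ≤ 1 := by rw [hβ']; nlinarith [sq_nonneg x]
  have hmid : 2 * β * (1 - β) * p * Δ ≤ 2 * (T * G * x ^ 4 / 2 ^ 16) := by
    have h0 : 0 ≤ l / δ * Δ := by positivity
    calc _ = 2 * β * ((1 - β) * p * Δ) := by ring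
      _ = 2 * (β * (l / δ * Δ)) := by rw [hwp]; ring
      _ ≤ 2 * (l / δ * Δ) := by nlinarith
      _ ≤ _ := by linarith
  have hG4 : G ^ 2 / (4 * G) = G / 4 := by field_simp
  have hG4' : (1 - β) ^ 2 * G ^ 2 / (4 * G) = x ^ 4 * G / 2 ^ 14 := by
    rw [hβ']
    field_simp
    ring
  rw [hG4, hG4', hs]
  have hpoly : 7 / 2 ^ 16 + (1 / 32 - x ^ 2 / 4096) * (1 / 256)
      ≤ (1 / 32 - x ^ 2 / 4096) * (1 / 128 - x / 8192) := by
    have hB : 127 / 4096 ≤ 1 / 32 - x ^ 2 / 4096 := by nlinarith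
    have hC : 31 / 8192 ≤ 1 / 128 - x / 8192 - 1 / 256 := by linarith
    nlinarith [mul_le_mul hB hC (by norm_num) (by linarith)]
  have hfin := mul_le_mul_of_nonneg_left hpoly (show 0 ≤ T * G * x ^ 4 by positivity)
  have hβsq : 1 - β ^ 2 = x ^ 2 * (1 / 32 - x ^ 2 / 4096) := by rw [hβ']; ring
  rw [hβsq]
  nlinarith

end Parameters

/-! ### Guarantees for the output -/

section Output

variable {σ Δ δ ε G β p q : ℝ} {x₁ : E n} {O : Kernel (E n × E n) (E n)} [IsMarkovKernel O]
  {K T : ℕ}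

/-- The mean norms of the momentum vectors are at most `ε / 8` on average. -/
lemma sum_lintegral_enorm_momentum_le (hΔ : 0 < Δ) (hδ : 0 < δ) (hε : 0 < ε)
    (hf : InClass Δ L x₁ f) (hO : IsStochasticOracle f σ O)
    (hG : G ^ 2 = (L : ℝ) ^ 2 + σ ^ 2) (hεG : ε ≤ G)
    (hβ : β = 1 - ε ^ 2 / (64 * G ^ 2))
    (hp : p = 64 * G ^ 2 * Real.log (16 * G / ε) / (δ * ε ^ 2))
    (hq : q = 4 * G * p)
    (hT : T = ⌈2 ^ 16 * G ^ 3 * Δ * Real.log (16 * G / ε) / (ε ^ 4 * δ)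
      * max 1 (G * δ / (8 * Δ))⌉₊) :
    ∑ k ∈ Finset.range T, ∫⁻ w, ‖w.2‖ₑ ∂((initStateLaw O x₁).bind (stepKernel O p q β ^ k))
      ≤ ENNReal.ofReal (T * (ε / 8)) := by
  have hG0 : 0 < G := hε.trans_le hεG
  have hl := two_le_log hε hεG
  have hp0 : 0 < p := by rw [hp]; positivity
  obtain ⟨h0, h1⟩ := momentum_weight_mem hε hεG hβ
  have hs : ε / (32 * G) ≤ 1 := by
    rw [div_le_one (by positivity)]
    linarith
  have hs0 : 0 < ε / (32 * G) := by positivity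
  have hκ : 0 < (1 - β ^ 2) * (2 * (ε / (32 * G)) - (ε / (32 * G)) ^ 2) :=
    mul_pos (by nlinarith) (by nlinarith)
  have h := sum_lintegral_enorm_chain_le hO hf.lipschitz hf.bddBelow hG h0 h1.le hp0
    (c := 4 * G) (s := ε / (32 * G)) (by positivity) hq hs0.le (by linarith) hf.gap T
  have h2 := h.trans (ENNReal.ofReal_le_ofReal (drift_bound hε hεG hδ hΔ hβ hp hT))
  rw [ENNReal.ofReal_mul hκ.le] at h2
  exact (ENNReal.mul_le_mul_iff_right (by simpa using hκ) ENNReal.ofReal_ne_top).1 h2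

/-- Averaging Markov's inequality over the candidates: the failure probability is at most
`(1 / 8 + 1 / 15) / (1 - 1 / 15) < 1 / 3`. -/
lemma stochINGD_not_stationary_le (hΔ : 0 < Δ) (hδ : 0 < δ) (hε : 0 < ε)
    (hf : InClass Δ L x₁ f) (hO : IsStochasticOracle f σ O)
    (hG : G ^ 2 = (L : ℝ) ^ 2 + σ ^ 2) (hεG : ε ≤ G)
    (hβ : β = 1 - ε ^ 2 / (64 * G ^ 2))
    (hp : p = 64 * G ^ 2 * Real.log (16 * G / ε) / (δ * ε ^ 2))
    (hq : q = 4 * G * p) (hK : K = ⌊p * δ⌋₊)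
    (hT : T = ⌈2 ^ 16 * G ^ 3 * Δ * Real.log (16 * G / ε) / (ε ^ 4 * δ)
      * max 1 (G * δ / (8 * Δ))⌉₊) (hT1 : 1 ≤ T) :
    stochINGD O x₁ p q β T K
      {r | ENNReal.ofReal ε ≤ Metric.infEDist 0 (goldstein f δ r.1)} ≤ 1 / 3 := by
  have hG0 : 0 < G := hε.trans_le hεG
  have hl := two_le_log hε hεG
  have hp0 : 0 < p := by rw [hp]; positivity
  obtain ⟨h0, h1⟩ := momentum_weight_mem hε hεG hβ
  have hb := pow_floor_le hε hεG hδ hβ hp hK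
  have hb0 : 0 ≤ β ^ K := pow_nonneg h0 K
  have hbG : β ^ K * G ≤ ε / 15 := by
    calc β ^ K * G ≤ ε / (15 * G) * G := by gcongr
      _ = ε / 15 := by field_simp
  have hb1 : β ^ K ≤ 1 / 15 := by
    refine hb.trans ?_
    rw [div_le_div_iff₀ (by positivity) (by norm_num)]
    linarith
  have hT0 : (0 : ℝ) < T := by exact_mod_cast hT1
  set S : Set (E n) := {x | ENNReal.ofReal ε ≤ Metric.infEDist 0 (goldstein f δ x)} with hSdef
  have hS : MeasurableSet S := measurableSet_le_infEDist_goldstein hf.lipschitz δ _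
  have hset : {r : E n × ℕ | ENNReal.ofReal ε ≤ Metric.infEDist 0 (goldstein f δ r.1)}
      = Prod.fst ⁻¹' S := rfl
  have hsum := sum_lintegral_enorm_momentum_le hΔ hδ hε hf hO hG hεG hβ hp hq hT
  rw [hset, stochINGD_apply O p q β x₁ hT1 K (measurable_fst hS)]
  have hterm : ∀ k ∈ Finset.range T,
      runLaw O x₁ p q β T {s | (s.1 (k - K + 1), s.2.2) ∈ Prod.fst ⁻¹' S}
      ≤ (∫⁻ w, ‖w.2‖ₑ ∂((initStateLaw O x₁).bind (stepKernel O p q β ^ k))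
          + ENNReal.ofReal (ε / 15)) * (ENNReal.ofReal ((1 - β ^ K) * ε))⁻¹ := by
    intro k hk
    have hS' : MeasurableSet (Prod.fst ⁻¹' S : Set (E n × E n)) := measurable_fst hS
    have hkT : k - K ≤ T := (Nat.sub_le k K).trans (Finset.mem_range.1 hk).le
    have h3 := lintegral_state_runLaw O p q β x₁ T hkT (measurable_one.indicator hS')
    rw [lintegral_indicator_one hS'] at h3
    have h4 : ∫⁻ s, (Prod.fst ⁻¹' S : Set (E n × E n)).indicator 1 (state (k - K + 1) s)
        ∂(runLaw O x₁ p q β T)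
        = runLaw O x₁ p q β T {s | (s.1 (k - K + 1), s.2.2) ∈ Prod.fst ⁻¹' S} :=
      lintegral_indicator_one (measurable_state (k - K + 1) hS')
    rw [← h4, h3]
    refine (measure_le_infEDist_le hO hf.lipschitz hG hG0.le h0 h1.le hp0 (by rw [hq]; positivity)
      hδ.le (floor_mul_le hp0 hδ hK) (by linarith) hε x₁ k).trans ?_
    rw [div_eq_mul_inv, div_eq_mul_inv, mul_assoc, ENNReal.ofReal_mul (by linarith),
      ENNReal.mul_inv (by simp) (by simp), ← ENNReal.ofReal_mul hb0]
    gcongr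
  calc _ ≤ (T : ℝ≥0∞)⁻¹ * ∑ k ∈ Finset.range T,
        (∫⁻ w, ‖w.2‖ₑ ∂((initStateLaw O x₁).bind (stepKernel O p q β ^ k))
          + ENNReal.ofReal (ε / 15)) * (ENNReal.ofReal ((1 - β ^ K) * ε))⁻¹ := by
        gcongr with k hk
        exact hterm k hk
    _ ≤ (T : ℝ≥0∞)⁻¹ * ((ENNReal.ofReal (T * (ε / 8)) + T * ENNReal.ofReal (ε / 15))
          * (ENNReal.ofReal ((1 - β ^ K) * ε))⁻¹) := by
        rw [← Finset.sum_mul, Finset.sum_add_distrib]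
        simp only [Finset.sum_const, Finset.card_range, nsmul_eq_mul]
        gcongr
    _ = ENNReal.ofReal ((T : ℝ)⁻¹ * ((T * (ε / 8) + T * (ε / 15)) * ((1 - β ^ K) * ε)⁻¹)) := by
        have h5 : 0 < (1 - β ^ K) * ε := mul_pos (by linarith) hε
        rw [ENNReal.ofReal_mul (p := (T : ℝ)⁻¹) (by positivity),
          ENNReal.ofReal_mul (p := T * (ε / 8) + T * (ε / 15)) (by positivity),
          ENNReal.ofReal_add (by positivity) (by positivity),
          ENNReal.ofReal_mul (p := (T : ℝ)) (q := ε / 15) hT0.le, ENNReal.ofReal_inv_of_pos hT0,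
          ENNReal.ofReal_inv_of_pos h5, ENNReal.ofReal_natCast]
    _ ≤ ENNReal.ofReal (1 / 3) := by
        refine ENNReal.ofReal_le_ofReal ?_
        have h5 : 0 < 1 - β ^ K := by linarith
        have h6 : (T : ℝ)⁻¹ * ((T * (ε / 8) + T * (ε / 15)) * ((1 - β ^ K) * ε)⁻¹)
            = (1 / 8 + 1 / 15) / (1 - β ^ K) := by
          field_simp
        rw [h6, div_le_div_iff₀ h5 (by norm_num)]
        linarith
    _ = 1 / 3 := by
        rw [ENNReal.ofReal_div_of_pos (by norm_num)]
        simp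

end Output

end StochINGD

end

open StochINGD

theorem theorem5 {n : ℕ} (f : StochINGD.E n → ℝ) (x₁ : StochINGD.E n)
    (L : ℝ≥0) (σ Δ δ ε : ℝ) (hσ : 0 ≤ σ) (hΔ : 0 < Δ) (hδ : 0 < δ) (hε : 0 < ε)
    (hf : StochINGD.InClass Δ L x₁ f)
    (O : Kernel (StochINGD.E n × StochINGD.E n) (StochINGD.E n)) [IsMarkovKernel O]
    (hO : StochINGD.IsStochasticOracle f σ O)
    (G β p q : ℝ) (K T : ℕ)
    (hG : G = √((L : ℝ) ^ 2 + σ ^ 2)) (hεG : ε ≤ G)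
    (hβ : β = 1 - ε ^ 2 / (64 * G ^ 2))
    (hp : p = 64 * G ^ 2 * Real.log (16 * G / ε) / (δ * ε ^ 2))
    (hq : q = 4 * G * p)
    (hK : K = ⌊p * δ⌋₊)
    (hT : T = ⌈2 ^ 16 * G ^ 3 * Δ * Real.log (16 * G / ε) / (ε ^ 4 * δ)
      * max 1 (G * δ / (8 * Δ))⌉₊) :
    -- the average of `𝔼 ‖m_t‖` over the run
    (∀ t ∈ Finset.Icc 1 T,
      Integrable (fun s => ‖s.2.1 t‖) (StochINGD.runLaw O x₁ p q β T)) ∧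
    (1 / (T : ℝ)) * ∑ t ∈ Finset.Icc 1 T, ∫ s, ‖s.2.1 t‖ ∂(StochINGD.runLaw O x₁ p q β T)
      ≤ ε / 4 ∧
    -- the output is `(δ, ε)`-stationary with probability at least `2 / 3`
    2 / 3 ≤ StochINGD.stochINGD O x₁ p q β T K {r | StochINGD.IsStationary f δ ε r.1} ∧
    -- indeed `d(0, ∂f(x + δB)) ≥ ε` has probability at most `1 / 3`
    StochINGD.stochINGD O x₁ p q β T K
      {r | ENNReal.ofReal ε ≤ Metric.infEDist 0 (StochINGD.goldstein f δ r.1)} ≤ 1 / 3 ∧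
    -- the number of stochastic gradient calls
    (∀ᵐ r ∂(StochINGD.stochINGD O x₁ p q β T K), r.2 = T + 1 ∧
      (r.2 : ℝ) ≤ 2 ^ 17 * (G ^ 3 * Δ / (ε ^ 4 * δ)) * Real.log (16 * G / ε)
        * max 1 (G * δ / (8 * Δ)) ∧
      (G * δ ≤ 8 * Δ →
        (r.2 : ℝ) ≤ 2 ^ 17 * (G ^ 3 * Δ / (ε ^ 4 * δ)) * Real.log (16 * G / ε))) := by
  have hG2 : G ^ 2 = (L : ℝ) ^ 2 + σ ^ 2 := by rw [hG, Real.sq_sqrt (by positivity)]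
  have hG0 : 0 < G := hε.trans_le hεG
  have hT1 : 1 ≤ T := by
    have h := (lower_bounds_iterations hε hεG hδ hΔ).2
    rw [hT, Nat.one_le_ceil_iff]
    exact lt_of_lt_of_le (by positivity) h
  have hT0 : (0 : ℝ) < T := by exact_mod_cast hT1
  have hsum := sum_lintegral_enorm_momentum_le hΔ hδ hε hf hO hG2 hεG hβ hp hq hT
  have hprob := stochINGD_not_stationary_le hΔ hδ hε hf hO hG2 hεG hβ hp hq hK hT hT1
  -- the sum of the mean norms, read off the records
  have hreindex : ∀ h : ℕ → ℝ≥0∞, ∑ t ∈ Finset.Icc 1 T, h t = ∑ k ∈ Finset.range T, h (k + 1) := by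
    intro h
    rw [← Finset.Ico_succ_right_eq_Icc, Finset.sum_Ico_eq_sum_range]
    simp [add_comm]
  have hsum' : ∑ t ∈ Finset.Icc 1 T, ∫⁻ s, ‖s.2.1 t‖ₑ ∂(runLaw O x₁ p q β T)
      ≤ ENNReal.ofReal (T * (ε / 8)) := by
    rw [hreindex]
    refine le_trans (le_of_eq (Finset.sum_congr rfl fun k hk => ?_)) hsum
    exact lintegral_state_runLaw O p q β x₁ T (Finset.mem_range.1 hk).le
      (h := fun z => ‖z.2‖ₑ) (by fun_prop)
  have hfin : ∀ t ∈ Finset.Icc 1 T, ∫⁻ s, ‖s.2.1 t‖ₑ ∂(runLaw O x₁ p q β T) ≠ ∞ := fun t ht =>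
    ((Finset.single_le_sum_of_canonicallyOrdered ht).trans hsum').trans_lt
      ENNReal.ofReal_lt_top |>.ne
  have hmeas : ∀ t, Measurable fun s : Run n => s.2.1 t := fun t =>
    measurable_snd.comp (measurable_state t)
  refine ⟨fun t ht => ?_, ?_, ?_, hprob, ?_⟩
  · exact Integrable.norm ⟨(hmeas t).aestronglyMeasurable, (hfin t ht).lt_top⟩
  · have hint : ∑ t ∈ Finset.Icc 1 T, ∫ s, ‖s.2.1 t‖ ∂(runLaw O x₁ p q β T)
        ≤ T * (ε / 8) := by
      have h2 : ∀ t, ∫ s, ‖s.2.1 t‖ ∂(runLaw O x₁ p q β T)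
          = (∫⁻ s, ‖s.2.1 t‖ₑ ∂(runLaw O x₁ p q β T)).toReal := fun t =>
        integral_norm_eq_lintegral_enorm (hmeas t).aestronglyMeasurable
      simp_rw [h2]
      rw [← ENNReal.toReal_sum hfin]
      exact ENNReal.toReal_le_of_le_ofReal (by positivity) hsum'
    rw [one_div_mul_eq_div, div_le_iff₀ hT0]
    nlinarith
  · have := isProbabilityMeasure_stochINGD O x₁ p q β T K hT1
    set A : Set (E n × ℕ) := {r | ENNReal.ofReal ε ≤ Metric.infEDist 0 (goldstein f δ r.1)} with hA
    have hAm : MeasurableSet A :=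
      measurable_fst (measurableSet_le_infEDist_goldstein hf.lipschitz δ _)
    have hsub : Aᶜ ⊆ {r | IsStationary f δ ε r.1} := fun r hr =>
      (not_le.1 (show ¬ENNReal.ofReal ε ≤ Metric.infEDist 0 (goldstein f δ r.1) from hr)).le
    refine le_trans ?_ (measure_mono hsub)
    rw [prob_compl_eq_one_sub hAm]
    refine le_trans ?_ (tsub_le_tsub_left hprob 1)
    refine ENNReal.le_sub_of_add_le_right (by simp) ?_
    rw [ENNReal.div_add_div_same]
    norm_num
  · have hcalls : ∀ᵐ r ∂(stochINGD O x₁ p q β T K), r.2 = T + 1 := by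
      have hm : MeasurableSet {r : E n × ℕ | ¬ r.2 = T + 1} :=
        (measurable_snd (measurableSet_singleton (T + 1))).compl
      rw [ae_iff, stochINGD_apply O p q β x₁ hT1 K hm]
      have hz : ∀ k ∈ Finset.range T, runLaw O x₁ p q β T
          {s | (s.1 (k - K + 1), s.2.2) ∈ {r : E n × ℕ | ¬ r.2 = T + 1}} = 0 := fun k _ =>
        ae_iff.1 (ae_count_runLaw O p q β x₁ T)
      rw [Finset.sum_eq_zero hz, mul_zero]
    have hbound := ceil_add_one_le hε hεG hδ hΔ hT
    filter_upwards [hcalls] with r hr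
    rw [hr]
    push_cast
    refine ⟨rfl, hbound, fun hGδ => ?_⟩
    rwa [max_eq_left (by rw [div_le_one (by positivity)]; exact hGδ), mul_one] at hbound
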